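/- Let $d\ge 2$ and $\mathcal N=\{z\in\mathbb Z^d:|z|=1\}$. An oriented cycle based at $0$ is a finite sequence $\gamma=(v_0,\dots,v_n)$ in $\mathbb Z^d$ with $v_j-v_{j-1}\in\mathcal N$, $v_0=v_n=0$, and otherwise mutually distinct vertices; its length is $|\gamma|=n$. Let $\Gamma_0$ be a set of such cycles with $\{x:\exists\gamma\in\Gamma_0,\ (0,x)\in\gamma\text{ or }(x,0)\in\gamma\}=\mathcal N$, let $\Omega=[0,\infty)^{\Gamma_0\times\mathbb Z^d}$ with the product $\sigma$-algebra, and let $(\tau_x\omega)_\gamma(y)=\omega_\gamma(x+y)$. Let $\mathbb P$ be a probability measure on $\Omega$ that is stationary and ergodic with respect to the shifts $(\tau_x)_{x\in\mathbb Z^d}$. Put $$c^\omega(x,y)=\sum_{\gamma\in\Gamma_0}\sum_{z\in\mathbb Z^d}\omega_\gamma(z)\mathbf 1_{(x,y)\in z+\gamma},\quad c_s^\omega(x,y)=\tfrac12\bigl(c^\omega(x,y)+c^\omega(y,x)\bigr),\quad \mu^{(2),\omega}(0)=\sum_{\gamma\in\Gamma_0}\sum_{y\in\mathbb Z^d}\omega_\gamma(y)|\gamma|^2\mathbf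 1_{0\in y+\gamma}.$$ Let $p,q\in(1,\infty]$ with $1/p+1/q<2/d$ (where $1/\infty=0$) and $(d,q)\ne(2,\infty)$, and assume $\mu^{(2),\omega}(0)\in L^p(\mathbb P)$ and $1/c_s^\omega(0,z)\in L^q(\mathbb P)$ for all $z\in\mathcal N$ (where $1/0=\infty$). Write $(L^\omega f)(x)=\sum_y c^\omega(x,y)(f(y)-f(x))$. Let $L^2_{\mathrm{cov}}$ be the space of random vectors $\Psi:\Omega\times\mathcal N\to\mathbb R$ such that, for $\mathbb P$-a.e. $\omega$, $\sum_{j=1}^n\Psi(\tau_{x_{j-1}}\omega,x_j-x_{j-1})=0$ for every closed nearest-neighbour path $(x_0,\dots,x_n)$, $x_n=x_0$, in $\mathbb Z^d$, and such that $\|\Psi\|_{\mathrm{cov}}^2=\frac12\mathbb E\bigl[\sum_{z\in\mathcal N}c_s^\omega(0,z)\Psi(\omega,z)^2\bigr]<\infty$; let $L^2_{\mathrm{pot}}$ be the closure in $L^2_{\mathrm{cov}}$ of $\{(\omega,z)\mapsto\varphi(\tau_z\omega)-\varphi(\omega):\varphi\text{ bounded and measurable}\}$. For $i=1,\dots,d$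 let $\chi^i:\Omega\times\mathbb Z^d\to\mathbb R$ be a corrector, that is, a random field such that $\chi^i|_{\Omega\times\mathcal N}\in L^2_{\mathrm{pot}}$ and, for $\mathbb P$-a.e. $\omega$, for all $x,y\in\mathbb Z^d$, $$\chi^i(\omega,y)-\chi^i(\omega,x)=\chi^i(\tau_x\omega,y-x),\qquad (L^\omega\chi^i(\omega,\cdot))(x)=\sum_{z\in\mathcal N}c^\omega(x,x+z)z^i .$$ Let $\rho=\dfrac{d}{d-2+d/q}$, $B(n)=\{x\in\mathbb Z^d:\|x\|_\infty\le n\}$ and $\|u\|_{r,B}=\bigl(\frac1{|B|}\sum_{x\in B}|u(x)|^r\bigr)^{1/r}$. Then, for $\mathbb P$-a.e. $\omega$ and all $i=1,\dots,d$, $$\lim_{n\to\infty}\frac1n\,\|\chi^i(\omega,\cdot)\|_{2\rho,B(n)}=0 .$$ -/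

import Mathlib

open MeasureTheory Filter Topology
open scoped ENNReal NNReal

noncomputable section

namespace CyclicWalk

/-- The vertex set of the lattice `ℤ^d`. -/
abbrev Site (d : ℕ) : Type := Fin d → ℤ

/-- The set `𝒩` of all `z ∈ ℤ^d` with Euclidean norm `|z| = 1`
(see `mem_neighbors` below). -/
def neighbors (d : ℕ) : Finset (Site d) :=
  (Finset.Icc (fun _ => (-1 : ℤ)) (fun _ => (1 : ℤ))).filter (fun z => ∑ i, z i ^ 2 = 1)

theorem mem_neighbors {d : ℕ} {z : Site d} :
    z ∈ neighbors d ↔ ∑ i, z i ^ 2 = 1 := by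
  unfold neighbors
  rw [Finset.mem_filter]
  refine ⟨fun h => h.2, fun h => ⟨?_, h⟩⟩
  have key : ∀ i, z i ^ 2 ≤ 1 := fun i => by
    rw [← h]
    exact Finset.single_le_sum (f := fun j => z j ^ 2) (fun j _ => sq_nonneg _)
      (Finset.mem_univ i)
  rw [Finset.mem_Icc]
  exact ⟨fun i => by have := key i; nlinarith, fun i => by have := key i; nlinarith⟩

/-- The box `B(n) = {x ∈ ℤ^d : ‖x‖_∞ ≤ n}`. -/
def box (d n : ℕ) : Finset (Site d) :=
  Finset.Icc (fun _ => -(n : ℤ)) (fun _ => (n : ℤ))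

/-- The space-averaged norm `‖u‖_{r,B} = (|B|⁻¹ ∑_{x ∈ B} |u x| ^ r) ^ (1/r)`, `0 < r < ∞`. -/
def avgNorm {d : ℕ} (r : ℝ) (B : Finset (Site d)) (u : Site d → ℝ) : ℝ :=
  ((B.card : ℝ)⁻¹ * ∑ x ∈ B, |u x| ^ r) ^ (1 / r)

/-- A finite oriented nearest-neighbour cycle `(v₀, …, v_n)` based at `0`: all vertices are
mutually distinct, except that the first and the last one are both `0`. -/
structure OrientedCycle (d : ℕ) where
  length : ℕ
  vertex : Fin (length + 1) → Site d
  first_eq : vertex 0 = 0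
  last_eq : vertex (Fin.last length) = 0
  step : ∀ j : Fin length, vertex j.succ - vertex j.castSucc ∈ neighbors d
  distinct : ∀ j k, j < k → vertex j = vertex k → j = 0 ∧ k = Fin.last length

/-- The vertex `x` belongs to the shifted cycle `z + γ`. -/
def OrientedCycle.HasVertex {d : ℕ} (γ : OrientedCycle d) (z x : Site d) : Prop :=
  ∃ j, z + γ.vertex j = x

/-- The oriented edge `(x, y)` belongs to the shifted cycle `z + γ`. -/
def OrientedCycle.HasEdge {d : ℕ} (γ : OrientedCycle d) (z x y : Site d) : Prop :=
  ∃ j : Fin γ.length, z + γ.vertex j.castSucc = x ∧ z + γ.vertex j.succ = y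

/-- The collection `Γ` of cycles based at `0` covers exactly the nearest-neighbour edges at `0`.
(There are only countably many cycles based at `0`, so `Γ` is automatically countable.) -/
def CoversNeighbors {d : ℕ} (Γ : Set (OrientedCycle d)) : Prop :=
  {x : Site d | ∃ γ ∈ Γ, γ.HasEdge 0 0 x ∨ γ.HasEdge 0 x 0} = {x | x ∈ neighbors d}

/-- The space of environments `[0, ∞)^(Γ × ℤ^d)`, with the product σ-algebra;
`ω (γ, x)` is the weight of the cycle `x + γ`. -/
abbrev Env {d : ℕ} (Γ : Set (OrientedCycle d)) : Type := Γ × Site d → ℝ≥0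

section

variable {d : ℕ} {Γ : Set (OrientedCycle d)}

/-- The space shift `(τ_x ω)_γ(y) = ω_γ(x + y)`. -/
def shift (x : Site d) (ω : Env Γ) : Env Γ := fun a => ω (a.1, x + a.2)

/-- Stationarity and ergodicity with respect to the space shifts. -/
structure IsStationaryErgodic (P : Measure (Env Γ)) : Prop where
  stationary : ∀ x : Site d, P.map (shift x) = P
  ergodic : ∀ A : Set (Env Γ), MeasurableSet A →
    (∀ x : Site d, shift x ⁻¹' A = A) → P A = 0 ∨ P A = 1

open Classical in
/-- The edge weights `c^ω(x, y) = ∑_γ ∑_z ω_γ(z) 1{(x, y) ∈ z + γ} ∈ [0, ∞]`. -/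
def edgeWeight (ω : Env Γ) (x y : Site d) : ℝ≥0∞ :=
  ∑' (γ : Γ) (z : Site d), if γ.1.HasEdge z x y then (ω (γ, z) : ℝ≥0∞) else 0

/-- The symmetric part `c_s^ω(x, y)` of the edge weights. -/
def symWeight (ω : Env Γ) (x y : Site d) : ℝ≥0∞ :=
  (edgeWeight ω x y + edgeWeight ω y x) / 2

open Classical in
/-- `μ^{(k),ω}(x) = ∑_γ ∑_y ω_γ(y) |γ|^k 1{x ∈ y + γ} ∈ [0, ∞]`. -/
def lengthMoment (k : ℕ) (ω : Env Γ) (x : Site d) : ℝ≥0∞ :=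
  ∑' (γ : Γ) (y : Site d),
    if γ.1.HasVertex y x then (ω (γ, y) : ℝ≥0∞) * (γ.1.length : ℝ≥0∞) ^ k else 0

/-- The `p`-`q` moment conditions: `μ^{(2)}(0) ∈ L^p(P)` and `1 / c_s(0, z) ∈ L^q(P)` for all
`z ∈ 𝒩`. The reciprocal is that of `[0, ∞]`, so that `1 / 0 = ∞`. -/
structure MomentCondition (P : Measure (Env Γ)) (p q : ℝ≥0∞) : Prop where
  upper : eLpNorm (fun ω : Env Γ => lengthMoment 2 ω 0) p P < ∞
  lower : ∀ z ∈ neighbors d, eLpNorm (fun ω : Env Γ => (symWeight ω 0 z)⁻¹) q P < ∞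

/-- The generator `(L^ω f)(x) = ∑_y c^ω(x, y) (f y - f x)`; at most `2d` terms are nonzero. -/
def generator (ω : Env Γ) (f : Site d → ℝ) (x : Site d) : ℝ :=
  ∑' y : Site d, (edgeWeight ω x y).toReal * (f y - f x)

/-- The local drift `V^i(ω, x) = (L^ω Π^i)(x)`, where `Π^i` is the `i`-th coordinate. -/
def localDrift (i : Fin d) (ω : Env Γ) (x : Site d) : ℝ :=
  generator ω (fun y => (y i : ℝ)) x

/-- The horizontal derivative `D_z φ (ω) = φ(τ_z ω) - φ(ω)`. -/
def horizontalD (φ : Env Γ → ℝ) (ω : Env Γ) (z : Site d) : ℝ :=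
  φ (shift z ω) - φ ω

/-- The cocycle property of a random field. -/
def IsCocycle (P : Measure (Env Γ)) (Ψ : Env Γ → Site d → ℝ) : Prop :=
  ∀ᵐ ω ∂P, ∀ x y : Site d, Ψ ω y - Ψ ω x = Ψ (shift x ω) (y - x)

/-! Random vectors on `Ω × 𝒩` are represented by functions on `Ω × ℤ^d` of which only the
values at `z ∈ 𝒩` are used. They are identified when they agree almost surely. -/

/-- The cycle condition of a random vector (only its values on `𝒩` enter). -/
def CycleCondition (P : Measure (Env Γ)) (Ψ : Env Γ → Site d → ℝ) : Prop :=
  ∀ᵐ ω ∂P, ∀ (n : ℕ) (x : ℕ → Site d), x 0 = x n →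
    (∀ j < n, x (j + 1) - x j ∈ neighbors d) →
    ∑ j ∈ Finset.range n, Ψ (shift (x j) ω) (x (j + 1) - x j) = 0

/-- `‖Ψ‖_cov² = ½ E[∑_{z ∈ 𝒩} c_s^ω(0, z) Ψ(ω, z)²] ∈ [0, ∞]`. -/
def covNormSq (P : Measure (Env Γ)) (Ψ : Env Γ → Site d → ℝ) : ℝ≥0∞ :=
  2⁻¹ * ∫⁻ ω, ∑ z ∈ neighbors d, symWeight ω 0 z * ENNReal.ofReal (Ψ ω z ^ 2) ∂P

/-- Membership of the restriction of `Ψ` to `Ω × 𝒩` in `L²_cov`. -/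
structure MemL2cov (P : Measure (Env Γ)) (Ψ : Env Γ → Site d → ℝ) : Prop where
  measurable : ∀ z ∈ neighbors d, Measurable (fun ω => Ψ ω z)
  cycle : CycleCondition P Ψ
  finite : covNormSq P Ψ < ∞

/-- Membership of the restriction of `Ψ` to `Ω × 𝒩` in `L²_pot`, the closure in `L²_cov` of the
set of all `D φ` with `φ` bounded and measurable. -/
structure MemL2pot (P : Measure (Env Γ)) (Ψ : Env Γ → Site d → ℝ) : Prop where
  memL2cov : MemL2cov P Ψ
  mem_closure : ∀ ε : ℝ≥0∞, 0 < ε → ∃ φ : Env Γ → ℝ, Measurable φ ∧ (∃ C, ∀ ω, |φ ω| ≤ C) ∧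
    covNormSq P (fun ω z => Ψ ω z - horizontalD φ ω z) < ε

/-- `χ` is a corrector in the `i`-th coordinate: a random field with the cocycle property whose
restriction to `Ω × 𝒩` is in `L²_pot` and which solves `L^ω χ = V^i` almost surely. -/
structure IsCorrector (P : Measure (Env Γ)) (i : Fin d) (χ : Env Γ → Site d → ℝ) : Prop where
  measurable : ∀ x, Measurable (fun ω => χ ω x)
  cocycle : IsCocycle P χ
  memL2pot : MemL2pot P χ
  poisson : ∀ᵐ ω ∂P, ∀ x, generator ω (χ ω) x = localDrift i ω x

end

/-- `ρ(d, q) = d / (d - 2 + d / q)`, with `1 / ∞ = 0`. -/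
def rho (d : ℕ) (q : ℝ≥0∞) : ℝ := d / ((d : ℝ) - 2 + d * (q⁻¹).toReal)

end CyclicWalk

end

-- Put r = 2/(1 + 1/q), whose Sobolev conjugate dr/(d - r) is 2ρ. The corrector is a limit of
-- horizontal gradients Dφ, φ bounded, in L² weighted by `symWeight`. As the inverse weights lie in
-- L^q, Hölder's inequality makes it a limit in unweighted L^r (`exists_lintegral_lt_of_memL2pot`).
--
-- Fix such a φ and let u(x) = χ(ω, x) - φ(τ_x ω). By the cocycle property the gradient of u at x is
-- χ - Dφ evaluated at τ_x ω, a stationary field with small r-th moment. A weak-type maximal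
-- inequality (`mul_measure_exists_lt_le`) controls its averages over all boxes at once: if E|χ -
-- Dφ_j|^r → 0, then almost surely, for each δ > 0, some j keeps every box average of the r-th power
-- of the gradient below δ^r.
--
-- What remains is deterministic (`exists_eAvgNorm_le`): such a bound forces the averaged norm of u
-- on B(n) with exponent 2ρ to be at most C(nδ + a), with a independent of n. This is a Sobolev
-- inequality with a cutoff, whose lower-order term n⁻¹‖u‖_r is controlled by Poincaré inequalities
-- over halved boxes. Adding back φ costs O(1). Divide by n, let n → ∞, then δ → 0.

namespace CyclicWalk

-- Sobolev inequalities for finitely supported functions on the lattice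

/-- The `i`-th unit vector of `ℤ^d`. -/
def unitVec {d : ℕ} (i : Fin d) : Site d := Pi.single i 1

theorem pi_count_int (d : ℕ) :
    Measure.pi (fun _ : Fin d => (Measure.count : Measure ℤ)) = Measure.count := by
  refine Measure.ext_of_singleton fun x => ?_
  rw [Measure.pi_singleton]
  simp

/-- Telescoping from t to a zero of f on its right, which exists because the support is finite. -/
theorem enorm_le_tsum_enorm_sub {f : ℤ → ℝ} (hf : f.support.Finite) (t : ℤ) :
    ‖f t‖ₑ ≤ ∑' s, ‖f (s + 1) - f s‖ₑ := by
  have h0 : ∃ N : ℕ, f (t + N) = 0 := by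
    by_contra! h
    refine Set.infinite_of_injective_forall_mem (f := fun N : ℕ => t + (N : ℤ)) ?_ h hf
    intro a b hab
    simpa using hab
  obtain ⟨N, hN⟩ := h0
  have key : f t = - ∑ j ∈ Finset.range N, (f (t + (j + 1 : ℕ)) - f (t + (j : ℕ))) := by
    rw [Finset.sum_range_sub (fun j : ℕ => f (t + j))]
    simp [hN]
  rw [key, enorm_neg]
  refine (enorm_sum_le _ _).trans ?_
  have hinj : Function.Injective (fun j : ℕ => t + (j : ℤ)) := fun a b hab => by simpa using hab
  calc ∑ j ∈ Finset.range N, ‖f (t + (j + 1 : ℕ)) - f (t + (j : ℕ))‖ₑ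
      ≤ ∑' j : ℕ, ‖f (t + (j + 1 : ℕ)) - f (t + (j : ℕ))‖ₑ := ENNReal.sum_le_tsum _
    _ = ∑' j : ℕ, (fun s => ‖f (s + 1) - f s‖ₑ) (t + (j : ℤ)) := by
        simp [add_assoc]
    _ ≤ ∑' s, ‖f (s + 1) - f s‖ₑ := ENNReal.tsum_comp_le_tsum_of_injective hinj _

theorem holderConjugate_natCast {d : ℕ} (hd : 2 ≤ d) :
    Real.HolderConjugate (d : ℝ) ((d : ℝ) / (d - 1)) := by
  have h : (2 : ℝ) ≤ d := by exact_mod_cast hd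
  rw [Real.holderConjugate_iff]
  refine ⟨by linarith, ?_⟩
  field_simp
  ring

/-- The Gagliardo-Nirenberg-Sobolev inequality on `ℤ^d` with exponent `1`. -/
theorem tsum_enorm_rpow_le_tsum_gradient {d : ℕ} (hd : 2 ≤ d) {f : Site d → ℝ}
    (hf : f.support.Finite) :
    ∑' x, ‖f x‖ₑ ^ ((d : ℝ) / (d - 1)) ≤
      (∑' x, ∑ i, ‖f (x + unitVec i) - f x‖ₑ) ^ ((d : ℝ) / (d - 1)) := by
  have hd' : (2 : ℝ) ≤ d := by exact_mod_cast hd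
  set g : Site d → ℝ≥0∞ := fun x => ∑ i, ‖f (x + unitVec i) - f x‖ₑ with hg
  -- The grid-lines inequality: |f x| is at most the sum of the gradient over each of the d
  -- coordinate lines through x, and |f x|^(d/(d-1)) is a product of d factors |f x|^(1/(d-1)), one
  -- per line.
  have h := lintegral_prod_lintegral_pow_le (fun _ : Fin d => (Measure.count : Measure ℤ))
    (p := (d : ℝ) / (d - 1)) (by simpa using holderConjugate_natCast hd)
    (f := g) (measurable_of_countable _)
  rw [pi_count_int, lintegral_count, lintegral_count] at h
  refine le_trans (ENNReal.tsum_le_tsum fun x => ?_) h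
  have hline : ∀ i, ‖f x‖ₑ ≤ ∫⁻ t, g (Function.update x i t) ∂(Measure.count : Measure ℤ) := by
    intro i
    rw [lintegral_count]
    have hs : (fun t => f (Function.update x i t)).support.Finite := by
      refine Set.Finite.of_injOn (f := fun t => Function.update x i t) (t := f.support) ?_ ?_ hf
      · intro t ht
        exact ht
      · exact (Function.update_injective x i).injOn
    have h1 := enorm_le_tsum_enorm_sub hs (x i)
    rw [Function.update_eq_self] at h1
    refine h1.trans (ENNReal.tsum_le_tsum fun t => ?_)
    have h2 : Function.update x i (t + 1) = Function.update x i t + unitVec i := by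
      ext j
      by_cases hj : j = i
      · subst hj; simp [unitVec]
      · simp [unitVec, hj]
    rw [h2]
    exact Finset.single_le_sum
      (f := fun i' => ‖f (Function.update x i t + unitVec i') - f (Function.update x i t)‖ₑ)
      (fun _ _ => zero_le) (Finset.mem_univ i)
  have hpow : ‖f x‖ₑ ^ ((d : ℝ) / (d - 1)) = ∏ _i : Fin d, ‖f x‖ₑ ^ ((1 : ℝ) / (d - 1)) := by
    rw [Finset.prod_const, ← ENNReal.rpow_natCast, ← ENNReal.rpow_mul]
    congr 1
    simp
    ring
  rw [hpow]
  simp only [Fintype.card_fin]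
  refine Finset.prod_le_prod' fun i _ => ?_
  exact ENNReal.rpow_le_rpow (hline i) (by apply div_nonneg <;> linarith)

/-- For b ≤ a, Bernoulli's inequality at b/a - 1 gives a^γ - b^γ ≤ γ a^(γ-1) (a - b); the term with
b only restores symmetry. -/
theorem abs_rpow_sub_rpow_le {a b γ : ℝ} (ha : 0 ≤ a) (hb : 0 ≤ b) (hγ : 1 ≤ γ) :
    |a ^ γ - b ^ γ| ≤ γ * (a ^ (γ - 1) + b ^ (γ - 1)) * |a - b| := by
  wlog hab : b ≤ a generalizing a b with H
  · have := H hb ha (le_of_not_ge hab)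
    rw [abs_sub_comm, abs_sub_comm a b, add_comm (a ^ (γ - 1))]
    exact this
  have h0 : b ^ γ ≤ a ^ γ := Real.rpow_le_rpow hb hab (by linarith)
  rw [abs_of_nonneg (sub_nonneg.2 h0), abs_of_nonneg (sub_nonneg.2 hab)]
  rcases ha.eq_or_lt with rfl | ha'
  · obtain rfl : b = 0 := le_antisymm hab hb
    simp
  have h1 := one_add_mul_self_le_rpow_one_add (s := b / a - 1)
    (by have := div_nonneg hb ha; linarith) hγ
  have h2 : (1 + (b / a - 1)) ^ γ = b ^ γ / a ^ γ := by
    rw [← Real.div_rpow hb ha]; ring_nf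
  have h3 : a ^ γ = a ^ (γ - 1) * a := by
    rw [← Real.rpow_add_one ha'.ne']; ring_nf
  have hpos : 0 < a ^ γ := Real.rpow_pos_of_pos ha' _
  rw [h2, le_div_iff₀ hpos] at h1
  have h4 : (1 + γ * (b / a - 1)) * a ^ γ = a ^ γ + γ * a ^ (γ - 1) * (b - a) := by
    rw [h3]; field_simp
  have h5 : 0 ≤ γ * b ^ (γ - 1) * (a - b) :=
    mul_nonneg (mul_nonneg (by linarith) (Real.rpow_nonneg hb _)) (by linarith)
  nlinarith

theorem enorm_abs_rpow (a : ℝ) {γ : ℝ} (hγ : 0 ≤ γ) : ‖|a| ^ γ‖ₑ = ‖a‖ₑ ^ γ := by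
  rw [Real.enorm_eq_ofReal (Real.rpow_nonneg (abs_nonneg a) γ),
    ← ENNReal.ofReal_rpow_of_nonneg (abs_nonneg a) hγ, ← Real.enorm_eq_ofReal (abs_nonneg a),
    Real.enorm_eq_ofReal_abs, Real.enorm_eq_ofReal_abs, abs_abs]

theorem enorm_abs_rpow_sub_le (a b : ℝ) {γ : ℝ} (hγ : 1 ≤ γ) :
    ‖|a| ^ γ - |b| ^ γ‖ₑ ≤
      ENNReal.ofReal γ * (‖a‖ₑ ^ (γ - 1) * ‖a - b‖ₑ + ‖b‖ₑ ^ (γ - 1) * ‖a - b‖ₑ) := by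
  have h := (abs_rpow_sub_rpow_le (abs_nonneg a) (abs_nonneg b) hγ).trans
    (mul_le_mul_of_nonneg_left (abs_abs_sub_abs_le a b) (by positivity))
  rw [← enorm_abs_rpow a (by linarith : 0 ≤ γ - 1), ← enorm_abs_rpow b (by linarith : 0 ≤ γ - 1),
    ← add_mul, ← mul_assoc]
  simp only [Real.enorm_eq_ofReal_abs]
  rw [abs_of_nonneg (Real.rpow_nonneg (abs_nonneg a) _),
    abs_of_nonneg (Real.rpow_nonneg (abs_nonneg b) _),
    ← ENNReal.ofReal_add (by positivity) (by positivity), ← ENNReal.ofReal_mul (by linarith),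
    ← ENNReal.ofReal_mul (by positivity)]
  exact ENNReal.ofReal_le_ofReal h

theorem tsum_mul_le_Lp_mul_Lq {α : Type*} [Countable α] {p q : ℝ} (hpq : p.HolderConjugate q)
    (f g : α → ℝ≥0∞) :
    ∑' a, f a * g a ≤ (∑' a, f a ^ p) ^ (1 / p) * (∑' a, g a ^ q) ^ (1 / q) := by
  let _ : MeasurableSpace α := ⊤
  have h := ENNReal.lintegral_mul_le_Lp_mul_Lq Measure.count hpq
    (measurable_of_countable f).aemeasurable (measurable_of_countable g).aemeasurable
  simpa only [lintegral_count, Pi.mul_apply] using h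

/-- The Sobolev inequality on `ℤ^d` with exponent `1 < r < d`. -/
theorem sobolev {d : ℕ} (hd : 2 ≤ d) {r : ℝ} (hr : 1 < r) (hrd : r < d) {f : Site d → ℝ}
    (hf : f.support.Finite) :
    (∑' x, ‖f x‖ₑ ^ (d * r / (d - r))) ^ (1 / (d * r / (d - r))) ≤
      ENNReal.ofReal (2 * d * (r * (d - 1) / (d - r))) *
        (∑' x, ∑ i, ‖f (x + unitVec i) - f x‖ₑ ^ r) ^ (1 / r) := by
  have hd' : (2 : ℝ) ≤ d := by exact_mod_cast hd
  have hdr : (0 : ℝ) < d - r := by linarith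
  have hd1 : (0 : ℝ) < d - 1 := by linarith
  have hr1 : (0 : ℝ) < r - 1 := by linarith
  have hr0 : (0 : ℝ) < r := by linarith
  have hd0 : (0 : ℝ) < d := by linarith
  set R : ℝ := d * r / (d - r) with hR
  -- The inequality with exponent 1 is applied to |f|^γ. This γ makes both γ·d/(d-1) and, after
  -- Hölder, (γ-1)·r/(r-1) equal to R, so the same sum A appears on both sides.
  set γ : ℝ := r * (d - 1) / (d - r) with hγ
  have hR0 : 0 < R := by positivity
  have hγ1 : 1 ≤ γ := by
    rw [hγ, le_div_iff₀ hdr]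
    nlinarith
  have hγκ : γ * (d / (d - 1)) = R := by rw [hγ, hR]; field_simp
  have hγr : (γ - 1) * (r / (r - 1)) = R := by rw [hγ, hR]; field_simp; ring
  have hconj : (r / (r - 1)).HolderConjugate r :=
    (Real.HolderConjugate.conjExponent hr).symm
  set A := ∑' x, ‖f x‖ₑ ^ R with hA
  set G := ∑' x, ∑ i, ‖f (x + unitVec i) - f x‖ₑ ^ r with hG
  have hAtop : A ≠ ∞ := by
    rw [hA, tsum_eq_sum (s := hf.toFinset)
      (fun x hx => by
        have : f x = 0 := by simpa using hx
        simp [this, hR0])]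
    exact ENNReal.sum_ne_top.2 fun x _ => ENNReal.rpow_ne_top_of_nonneg hR0.le enorm_ne_top
  rcases eq_or_ne A 0 with hA0 | hA0
  · rw [hA0, ENNReal.zero_rpow_of_pos (by positivity)]
    exact zero_le
  have hF : (fun x => |f x| ^ γ).support.Finite := hf.subset fun x hx => by
    intro h0
    apply hx
    simp [h0, (by linarith : γ ≠ 0)]
  have h := tsum_enorm_rpow_le_tsum_gradient hd hF
  have hL : ∀ x, ‖|f x| ^ γ‖ₑ ^ ((d : ℝ) / (d - 1)) = ‖f x‖ₑ ^ R := fun x => by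
    rw [enorm_abs_rpow _ (by linarith), ← ENNReal.rpow_mul, hγκ]
  simp only [hL] at h
  rw [← hA] at h
  set K := ENNReal.ofReal γ with hK
  set B := A ^ (1 / (r / (r - 1))) * G ^ (1 / r) with hB
  have hgrad : ∀ i : Fin d, (∑' x, ‖f (x + unitVec i) - f x‖ₑ ^ r) ≤ G := fun i =>
    ENNReal.tsum_le_tsum fun x => Finset.single_le_sum
      (f := fun j => ‖f (x + unitVec j) - f x‖ₑ ^ r) (fun _ _ => zero_le) (Finset.mem_univ i)
  have hh : ∀ (i : Fin d) (v : Site d),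
      ∑' x, ‖f (x + v)‖ₑ ^ (γ - 1) * ‖f (x + unitVec i) - f x‖ₑ ≤ B := fun i v => by
    refine (tsum_mul_le_Lp_mul_Lq hconj _ _).trans ?_
    simp only [← ENNReal.rpow_mul, hγr]
    rw [show ∑' x, ‖f (x + v)‖ₑ ^ R = A from
      (Equiv.addRight v).tsum_eq (fun x => ‖f x‖ₑ ^ R)]
    exact mul_le_mul' le_rfl (ENNReal.rpow_le_rpow (hgrad i) (by positivity))
  have hsum : ∑' x, ∑ i, ‖|f (x + unitVec i)| ^ γ - |f x| ^ γ‖ₑ ≤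
      ENNReal.ofReal (2 * d * γ) * B := by
    rw [Summable.tsum_finsetSum fun _ _ => ENNReal.summable]
    calc ∑ i, ∑' x, ‖|f (x + unitVec i)| ^ γ - |f x| ^ γ‖ₑ
        ≤ ∑ _i : Fin d, K * (B + B) := Finset.sum_le_sum fun i _ => by
          refine (ENNReal.tsum_le_tsum fun x => enorm_abs_rpow_sub_le _ _ hγ1).trans ?_
          rw [ENNReal.tsum_mul_left, ENNReal.tsum_add]
          refine mul_le_mul' le_rfl (add_le_add (hh i _) ?_)
          simpa using hh i 0
      _ = ENNReal.ofReal (2 * d * γ) * B := by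
          rw [ENNReal.ofReal_mul (by positivity), ENNReal.ofReal_mul (by positivity)]
          simp only [Finset.sum_const, Finset.card_univ, Fintype.card_fin, nsmul_eq_mul,
            ENNReal.ofReal_natCast, ENNReal.ofReal_ofNat]
          ring
  have h1 : A ≤ (ENNReal.ofReal (2 * d * γ) * B) ^ ((d : ℝ) / (d - 1)) :=
    h.trans (ENNReal.rpow_le_rpow hsum (by positivity))
  have h2 : A ^ (((d : ℝ) / (d - 1))⁻¹) ≤ ENNReal.ofReal (2 * d * γ) * B :=
    (ENNReal.rpow_inv_le_iff (by positivity)).2 h1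
  -- The exponent (d-1)/d on the left exceeds that of A on the right by 1/R; since 0 < A < ∞ the
  -- common power of A cancels.
  have hexp : ((d : ℝ) / (d - 1))⁻¹ = 1 / R + 1 / (r / (r - 1)) := by
    rw [hR]; field_simp; ring
  rw [hexp, ENNReal.rpow_add _ _ hA0 hAtop, hB, mul_comm (A ^ (1 / (r / (r - 1)))),
    ← mul_assoc] at h2
  have hc0 : A ^ (1 / (r / (r - 1))) ≠ 0 := by simp [ENNReal.rpow_eq_zero_iff, hA0, hAtop]
  have hct : A ^ (1 / (r / (r - 1))) ≠ ∞ :=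
    ENNReal.rpow_ne_top_of_nonneg (by positivity) hAtop
  exact (ENNReal.mul_le_mul_iff_left hc0 hct).1 h2

-- Box averages and Poincaré inequalities

/-- The space-averaged norm `avgNorm`, with values in `[0, ∞]`. -/
noncomputable def eAvgNorm {d : ℕ} (r : ℝ) (B : Finset (Site d)) (u : Site d → ℝ) : ℝ≥0∞ :=
  ((B.card : ℝ≥0∞)⁻¹ * ∑ x ∈ B, ‖u x‖ₑ ^ r) ^ (1 / r)

/-- The `r`-th power of the `ℓ^r`-norm of the discrete gradient at `x`. -/
noncomputable def gradPow {d : ℕ} (r : ℝ) (u : Site d → ℝ) (x : Site d) : ℝ≥0∞ :=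
  ∑ i, ‖u (x + unitVec i) - u x‖ₑ ^ r

theorem mem_box {d n : ℕ} {x : Site d} : x ∈ box d n ↔ ∀ i, |x i| ≤ n := by
  simp only [box, Finset.mem_Icc, Pi.le_def, abs_le, forall_and]

theorem card_box (d n : ℕ) : (box d n).card = (2 * n + 1) ^ d := by
  rw [box, Pi.card_Icc]
  simp only [Int.card_Icc, Finset.prod_const, Finset.card_univ, Fintype.card_fin]
  congr 1
  omega

theorem card_box_ne_zero (d n : ℕ) : ((box d n).card : ℝ≥0∞) ≠ 0 := by
  rw [card_box]; positivity

theorem card_box_le {d m n k : ℕ} (h : 2 * m + 1 ≤ k * (2 * n + 1)) :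
    ((box d m).card : ℝ≥0∞) ≤ (k : ℝ≥0∞) ^ d * (box d n).card := by
  rw [card_box, card_box]
  exact_mod_cast (Nat.pow_le_pow_left h d).trans_eq (mul_pow _ _ _)

theorem box_mono {d m n : ℕ} (h : m ≤ n) : box d m ⊆ box d n := fun x hx => by
  rw [mem_box] at hx ⊢
  exact fun i => (hx i).trans (by exact_mod_cast h)

theorem add_mem_box {d m n : ℕ} {x y : Site d} (hx : x ∈ box d m) (hy : y ∈ box d n) :
    x + y ∈ box d (m + n) := by
  rw [mem_box] at *
  intro i
  push_cast
  exact (abs_add_le _ _).trans (add_le_add (hx i) (hy i))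

theorem sub_mem_box {d m n : ℕ} {x y : Site d} (hx : x ∈ box d m) (hy : y ∈ box d n) :
    x - y ∈ box d (m + n) := by
  rw [mem_box] at *
  intro i
  push_cast
  exact (abs_sub _ _).trans (add_le_add (hx i) (hy i))

theorem sum_box_add_le {d l M : ℕ} {v : Site d} (hv : v ∈ box d M) (g : Site d → ℝ≥0∞) :
    ∑ y ∈ box d l, g (y + v) ≤ ∑ y ∈ box d (l + M), g y := by
  classical
  rw [← Finset.sum_image (s := box d l) (g := fun y => y + v) (f := g)
    (fun a _ b _ hab => add_right_cancel hab)]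
  refine Finset.sum_le_sum_of_subset fun y hy => ?_
  obtain ⟨z, hz, rfl⟩ := Finset.mem_image.1 hy
  exact add_mem_box hz hv

theorem rpow_le_of_le_rpow_one_div {a b : ℝ≥0∞} {r : ℝ} (hr : 0 < r) (h : a ^ (1 / r) ≤ b) :
    a ≤ b ^ r := by
  rwa [one_div, ENNReal.rpow_inv_le_iff hr] at h

theorem rpow_rpow_one_div (a : ℝ≥0∞) {r : ℝ} (hr : 0 < r) : (a ^ r) ^ (1 / r) = a := by
  rw [← ENNReal.rpow_mul, mul_one_div_cancel hr.ne', ENNReal.rpow_one]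

/-- Induction on the ℓ¹-length of h. Moving a nonzero coordinate one step towards 0 stays inside
B(M), and by Minkowski costs one gradient term, whose shifted sum is contained in B(l + M). -/
theorem lp_translate_sub_le {d : ℕ} {r : ℝ} (hr : 1 ≤ r) (u : Site d → ℝ) (l M : ℕ) (L : ℕ) :
    ∀ h ∈ box d M, ∑ i, (h i).natAbs = L →
      (∑ y ∈ box d l, ‖u (y + h) - u y‖ₑ ^ r) ^ (1 / r) ≤
        L * (∑ y ∈ box d (l + M), gradPow r u y) ^ (1 / r) := by
  have hr0 : 0 < r := by linarith
  set S := ∑ y ∈ box d (l + M), gradPow r u y with hS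
  have hstep : ∀ (v : Site d) (i : Fin d), v ∈ box d M →
      (∑ y ∈ box d l, ‖u (y + v + unitVec i) - u (y + v)‖ₑ ^ r) ^ (1 / r) ≤ S ^ (1 / r) := by
    intro v i hv
    refine ENNReal.rpow_le_rpow ?_ (by positivity)
    refine (sum_box_add_le hv fun y => ‖u (y + unitVec i) - u y‖ₑ ^ r).trans ?_
    exact Finset.sum_le_sum fun y _ => Finset.single_le_sum
      (f := fun j => ‖u (y + unitVec j) - u y‖ₑ ^ r) (fun _ _ => zero_le) (Finset.mem_univ i)
  induction L with
  | zero =>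
    intro h _ hL
    have : h = 0 := by
      ext i
      simpa using (Finset.sum_eq_zero_iff.1 hL) i (Finset.mem_univ i)
    subst this
    simp [hr0]
  | succ L ih =>
    intro h hh hL
    obtain ⟨i, hi⟩ : ∃ i, h i ≠ 0 := by
      by_contra! h0
      simp [h0] at hL
    have htri : ∀ h' : Site d, h' ∈ box d M → ∑ j, (h' j).natAbs = L →
        (∑ y ∈ box d l, ‖u (y + h) - u (y + h')‖ₑ ^ r) ^ (1 / r) ≤ S ^ (1 / r) →
        (∑ y ∈ box d l, ‖u (y + h) - u y‖ₑ ^ r) ^ (1 / r) ≤ ((L + 1 : ℕ) : ℝ≥0∞) * S ^ (1 / r) := by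
      intro h' hm hL' hgrad
      calc (∑ y ∈ box d l, ‖u (y + h) - u y‖ₑ ^ r) ^ (1 / r)
          ≤ (∑ y ∈ box d l, (‖u (y + h') - u y‖ₑ + ‖u (y + h) - u (y + h')‖ₑ) ^ r) ^ (1 / r) := by
            refine ENNReal.rpow_le_rpow (Finset.sum_le_sum fun y _ => ?_) (by positivity)
            refine ENNReal.rpow_le_rpow ?_ hr0.le
            refine le_trans (le_of_eq ?_) (enorm_add_le _ _)
            congr 1; ring
        _ ≤ _ := ENNReal.Lp_add_le _ _ _ hr
        _ ≤ L * S ^ (1 / r) + S ^ (1 / r) := add_le_add (ih h' hm hL') hgrad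
        _ = _ := by push_cast; ring
    have hsum : ∀ h' : Site d, (∀ j, j ≠ i → h' j = h j) → (h' i).natAbs + 1 = (h i).natAbs →
        ∑ j, (h' j).natAbs = L := by
      intro h' hne hei
      rw [← Finset.add_sum_erase _ _ (Finset.mem_univ i)] at hL ⊢
      rw [Finset.sum_congr rfl fun j hj => by rw [hne j (Finset.ne_of_mem_erase hj)]]
      omega
    have hbox : ∀ h' : Site d, (∀ j, j ≠ i → h' j = h j) → (h' i).natAbs + 1 = (h i).natAbs →
        h' ∈ box d M := by
      intro h' hne hei
      rw [mem_box] at hh ⊢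
      intro j
      by_cases hj : j = i
      · subst hj
        have := hh j
        rw [Int.abs_eq_natAbs] at this ⊢
        omega
      · rw [hne j hj]; exact hh j
    rcases lt_or_gt_of_ne hi with hneg | hpos
    · have hne : ∀ j, j ≠ i → (h + unitVec i) j = h j := fun j hj => by simp [unitVec, hj]
      have hei : ((h + unitVec i) i).natAbs + 1 = (h i).natAbs := by
        simp only [unitVec, Pi.add_apply, Pi.single_eq_same]
        omega
      refine htri (h + unitVec i) (hbox _ hne hei) (hsum _ hne hei) ?_
      refine le_trans (le_of_eq ?_) (hstep h i hh)
      simp only [← add_assoc, enorm_sub_rev (u (_ + h))]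
    · have hne : ∀ j, j ≠ i → (h - unitVec i) j = h j := fun j hj => by simp [unitVec, hj]
      have hei : ((h - unitVec i) i).natAbs + 1 = (h i).natAbs := by
        simp only [unitVec, Pi.sub_apply, Pi.single_eq_same]
        omega
      refine htri (h - unitVec i) (hbox _ hne hei) (hsum _ hne hei) ?_
      refine le_trans (le_of_eq ?_) (hstep (h - unitVec i) i (hbox _ hne hei))
      simp only [add_assoc, sub_add_cancel]

theorem sum_natAbs_le {d M : ℕ} {h : Site d} (hh : h ∈ box d M) :
    ∑ i, (h i).natAbs ≤ d * M := by
  rw [mem_box] at hh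
  refine (Finset.sum_le_card_nsmul _ _ M fun i _ => ?_).trans_eq (by simp)
  have := hh i
  rw [Int.abs_eq_natAbs] at this
  omega

/-- A Poincaré inequality for two boxes. -/
theorem sum_product_enorm_sub_le {d : ℕ} {r : ℝ} (hr : 1 ≤ r) (u : Site d → ℝ) {l n : ℕ}
    (hln : l ≤ n) :
    ∑ x ∈ box d n ×ˢ box d l, ‖u x.1 - u x.2‖ₑ ^ r ≤
      (box d (2 * n)).card * (((2 * d * n : ℕ) : ℝ≥0∞) ^ r *
        ∑ y ∈ box d (3 * n), gradPow r u y) := by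
  have hr0 : 0 < r := by linarith
  have h1 : ∀ h ∈ box d (2 * n), ∑ y ∈ box d l, ‖u (y + h) - u y‖ₑ ^ r ≤
      ((2 * d * n : ℕ) : ℝ≥0∞) ^ r * ∑ y ∈ box d (3 * n), gradPow r u y := by
    intro h hh
    have h2 := lp_translate_sub_le hr u l (2 * n) _ h hh rfl
    refine (rpow_le_of_le_rpow_one_div hr0 h2).trans ?_
    rw [ENNReal.mul_rpow_of_nonneg _ _ hr0.le, ← ENNReal.rpow_mul, one_div_mul_cancel hr0.ne',
      ENNReal.rpow_one]
    refine mul_le_mul' (ENNReal.rpow_le_rpow ?_ hr0.le)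
      (Finset.sum_le_sum_of_subset (box_mono (by omega)))
    have := sum_natAbs_le hh
    exact_mod_cast this.trans_eq (by ring)
  calc ∑ x ∈ box d n ×ˢ box d l, ‖u x.1 - u x.2‖ₑ ^ r
      = ∑ y ∈ box d l, ∑ x ∈ box d n, ‖u x - u y‖ₑ ^ r := Finset.sum_product_right _ _ _
    -- Substitute x = y + h; as B(l) ⊆ B(n), the increment h stays in B(2n).
    _ ≤ ∑ y ∈ box d l, ∑ h ∈ box d (2 * n), ‖u (y + h) - u y‖ₑ ^ r := by
        refine Finset.sum_le_sum fun y hy => ?_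
        have hy' : -y ∈ box d n := by
          rw [mem_box] at hy ⊢
          intro i
          rw [Pi.neg_apply, abs_neg]
          exact (hy i).trans (by exact_mod_cast hln)
        have h3 := sum_box_add_le (l := n) hy' fun h => ‖u (y + h) - u y‖ₑ ^ r
        rw [← two_mul] at h3
        simpa using h3
    _ = ∑ h ∈ box d (2 * n), ∑ y ∈ box d l, ‖u (y + h) - u y‖ₑ ^ r := Finset.sum_comm
    _ ≤ _ := by
        refine (Finset.sum_le_card_nsmul _ _ _ h1).trans_eq ?_
        rw [nsmul_eq_mul]

/-- Both averages are norms of functions of one variable on B(n) × B(l), so Minkowski leaves the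
norm of u(x) - u(y), to which the Poincaré inequality applies. The constant 12^d comes from |B(2n)|
≤ 2^d |B(n)| and |B(3n)| ≤ 6^d |B(l)|; the latter uses n ≤ 2l. -/
theorem eAvgNorm_le_add {d : ℕ} {r : ℝ} (hr : 1 ≤ r) (u : Site d → ℝ) {δ : ℝ≥0∞} {l n : ℕ}
    (hln : l ≤ n) (hnl : n ≤ 2 * l)
    (hδ : ∑ y ∈ box d (3 * n), gradPow r u y ≤ δ ^ r * (box d (3 * n)).card) :
    eAvgNorm r (box d n) u ≤ eAvgNorm r (box d l) u + 2 * d * 12 ^ d * n * δ := by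
  have hr0 : 0 < r := by linarith
  set b := ((box d n).card : ℝ≥0∞) with hb
  set c := ((box d l).card : ℝ≥0∞) with hc
  have hb0 : b ≠ 0 := card_box_ne_zero d n
  have hc0 : c ≠ 0 := card_box_ne_zero d l
  have hbt : b ≠ ∞ := ENNReal.natCast_ne_top _
  have hct : c ≠ ∞ := ENNReal.natCast_ne_top _
  have hmul : ∀ s : ℝ≥0∞, b⁻¹ * s = (b * c)⁻¹ * (c * s) := fun s => by
    rw [ENNReal.mul_inv (Or.inl hb0) (Or.inl hbt), mul_assoc, ← mul_assoc c⁻¹,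
      ENNReal.inv_mul_cancel hc0 hct, one_mul]
  have hmul' : ∀ s : ℝ≥0∞, c⁻¹ * s = (b * c)⁻¹ * (b * s) := fun s => by
    rw [ENNReal.mul_inv (Or.inl hb0) (Or.inl hbt), mul_comm b⁻¹, mul_assoc, ← mul_assoc b⁻¹,
      ENNReal.inv_mul_cancel hb0 hbt, one_mul]
  have hM : (∑ x ∈ box d n ×ˢ box d l, ‖u x.1‖ₑ ^ r) ^ (1 / r) ≤
      (∑ x ∈ box d n ×ˢ box d l, ‖u x.2‖ₑ ^ r) ^ (1 / r) +
        (∑ x ∈ box d n ×ˢ box d l, ‖u x.1 - u x.2‖ₑ ^ r) ^ (1 / r) := by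
    refine le_trans ?_ (ENNReal.Lp_add_le _ _ _ hr)
    refine ENNReal.rpow_le_rpow (Finset.sum_le_sum fun x _ => ?_) (by positivity)
    refine ENNReal.rpow_le_rpow ?_ hr0.le
    refine le_trans (le_of_eq ?_) (enorm_add_le _ _)
    congr 1; ring
  have e1 : ∑ x ∈ box d n ×ˢ box d l, ‖u x.1‖ₑ ^ r = c * ∑ x ∈ box d n, ‖u x‖ₑ ^ r := by
    rw [Finset.sum_product_right]; simp [hc]
  have e2 : ∑ x ∈ box d n ×ˢ box d l, ‖u x.2‖ₑ ^ r = b * ∑ x ∈ box d l, ‖u x‖ₑ ^ r := by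
    rw [Finset.sum_product]; simp [hb]
  have e3 : (b * c)⁻¹ * ∑ x ∈ box d n ×ˢ box d l, ‖u x.1 - u x.2‖ₑ ^ r ≤
      12 ^ d * (((2 * d * n : ℕ) : ℝ≥0∞) * δ) ^ r := by
    have h2 : ((box d (2 * n)).card : ℝ≥0∞) ≤ ((2 : ℕ) : ℝ≥0∞) ^ d * b := card_box_le (by omega)
    have h3 : ((box d (3 * n)).card : ℝ≥0∞) ≤ ((6 : ℕ) : ℝ≥0∞) ^ d * c := card_box_le (by omega)
    calc (b * c)⁻¹ * ∑ x ∈ box d n ×ˢ box d l, ‖u x.1 - u x.2‖ₑ ^ r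
        ≤ (b * c)⁻¹ * (((2 : ℕ) : ℝ≥0∞) ^ d * b * (((2 * d * n : ℕ) : ℝ≥0∞) ^ r *
            (δ ^ r * (((6 : ℕ) : ℝ≥0∞) ^ d * c)))) := by
          refine mul_le_mul' le_rfl ((sum_product_enorm_sub_le hr u hln).trans ?_)
          exact mul_le_mul' h2 (mul_le_mul' le_rfl (hδ.trans (mul_le_mul' le_rfl h3)))
      _ = ((b * c)⁻¹ * (b * c)) * ((((2 : ℕ) : ℝ≥0∞) ^ d * ((6 : ℕ) : ℝ≥0∞) ^ d) *
            (((2 * d * n : ℕ) : ℝ≥0∞) ^ r * δ ^ r)) := by ring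
      _ = _ := by
          rw [ENNReal.inv_mul_cancel (mul_ne_zero hb0 hc0) (ENNReal.mul_ne_top hbt hct), one_mul,
            ENNReal.mul_rpow_of_nonneg _ _ hr0.le, ← mul_pow]
          norm_num
  calc eAvgNorm r (box d n) u
      = ((b * c)⁻¹) ^ (1 / r) * (∑ x ∈ box d n ×ˢ box d l, ‖u x.1‖ₑ ^ r) ^ (1 / r) := by
        rw [eAvgNorm, ← hb, hmul, e1, ENNReal.mul_rpow_of_nonneg _ _ (by positivity)]
    _ ≤ ((b * c)⁻¹) ^ (1 / r) * ((∑ x ∈ box d n ×ˢ box d l, ‖u x.2‖ₑ ^ r) ^ (1 / r) +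
        (∑ x ∈ box d n ×ˢ box d l, ‖u x.1 - u x.2‖ₑ ^ r) ^ (1 / r)) := mul_le_mul' le_rfl hM
    _ = eAvgNorm r (box d l) u +
        ((b * c)⁻¹ * ∑ x ∈ box d n ×ˢ box d l, ‖u x.1 - u x.2‖ₑ ^ r) ^ (1 / r) := by
        rw [mul_add, eAvgNorm, ← hc, hmul', e2, ← ENNReal.mul_rpow_of_nonneg _ _ (by positivity),
          ← ENNReal.mul_rpow_of_nonneg _ _ (by positivity)]
    _ ≤ eAvgNorm r (box d l) u + 2 * d * 12 ^ d * n * δ := by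
        refine add_le_add le_rfl ?_
        calc _ ≤ (12 ^ d * (((2 * d * n : ℕ) : ℝ≥0∞) * δ) ^ r) ^ (1 / r) :=
              ENNReal.rpow_le_rpow e3 (by positivity)
          _ = ((12 : ℝ≥0∞) ^ d) ^ (1 / r) * (((2 * d * n : ℕ) : ℝ≥0∞) * δ) := by
              rw [ENNReal.mul_rpow_of_nonneg _ _ (by positivity), rpow_rpow_one_div _ hr0]
          _ ≤ ((12 : ℝ≥0∞) ^ d) ^ (1 : ℝ) * (((2 * d * n : ℕ) : ℝ≥0∞) * δ) := by
              refine mul_le_mul' (ENNReal.rpow_le_rpow_of_exponent_le ?_ ?_) le_rfl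
              · exact one_le_pow₀ (by norm_num)
              · rw [div_le_one hr0]; exact hr
          _ = _ := by
              rw [ENNReal.rpow_one]; push_cast; ring

/-- Halving the box down to B(1): the errors are proportional to the radii and sum like a geometric
series. -/
theorem eAvgNorm_le_of_gradPow_le {d : ℕ} {r : ℝ} (hr : 1 ≤ r) (u : Site d → ℝ) {δ : ℝ≥0∞}
    (hδ : ∀ n, ∑ y ∈ box d n, gradPow r u y ≤ δ ^ r * (box d n).card) (n : ℕ) (hn : 1 ≤ n) :
    eAvgNorm r (box d n) u ≤ eAvgNorm r (box d 1) u + 8 * d * 12 ^ d * n * δ := by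
  induction n using Nat.strong_induction_on with
  | _ n ih =>
    rcases hn.eq_or_lt with rfl | hn'
    · exact le_self_add
    refine (eAvgNorm_le_add hr u (l := (n + 1) / 2) (by omega) (by omega) (hδ _)).trans ?_
    refine (add_le_add (ih ((n + 1) / 2) (by omega) (by omega)) le_rfl).trans ?_
    rw [add_assoc]
    refine add_le_add le_rfl ?_
    -- The induction closes because 4⌈n/2⌉ + n ≤ 4n for n ≥ 2; this fixes the factor 8 = 2 · 4.
    have h4 : ((4 * ((n + 1) / 2) + n : ℕ) : ℝ≥0∞) ≤ ((4 * n : ℕ) : ℝ≥0∞) := by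
      exact_mod_cast (by omega : 4 * ((n + 1) / 2) + n ≤ 4 * n)
    calc _ = 2 * d * 12 ^ d * ((4 * ((n + 1) / 2) + n : ℕ) : ℝ≥0∞) * δ := by push_cast; ring
      _ ≤ 2 * d * 12 ^ d * ((4 * n : ℕ) : ℝ≥0∞) * δ := by gcongr
      _ = _ := by push_cast; ring

-- Cutoffs and the Sobolev inequality on boxes

theorem norm_le_iff_mem_box {d n : ℕ} {x : Site d} : ‖x‖ ≤ n ↔ x ∈ box d n := by
  rw [pi_norm_le_iff_of_nonneg (Nat.cast_nonneg n), mem_box]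
  refine forall_congr' fun i => ?_
  rw [Int.norm_eq_abs]
  exact_mod_cast Iff.rfl

/-- A Lipschitz function which is `1` on `B(n)` and `0` outside `B(2n)`. -/
noncomputable def cutoff {d : ℕ} (n : ℕ) (x : Site d) : ℝ := max 0 (min 1 (2 - ‖x‖ / n))

theorem cutoff_nonneg {d n : ℕ} (x : Site d) : 0 ≤ cutoff n x := le_max_left _ _

theorem cutoff_le_one {d n : ℕ} (x : Site d) : cutoff n x ≤ 1 :=
  max_le zero_le_one (min_le_left _ _)

theorem cutoff_eq_one {d n : ℕ} {x : Site d} (hx : x ∈ box d n) : cutoff n x = 1 := by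
  have h : ‖x‖ / n ≤ 1 := div_le_one_of_le₀ (norm_le_iff_mem_box.2 hx) (Nat.cast_nonneg n)
  rw [cutoff, min_eq_left (by linarith), max_eq_right zero_le_one]

theorem cutoff_eq_zero {d n : ℕ} (hn : 1 ≤ n) {x : Site d} (hx : x ∉ box d (2 * n)) :
    cutoff n x = 0 := by
  have hn' : (0 : ℝ) < n := by exact_mod_cast hn
  have h : 2 ≤ ‖x‖ / n := by
    rw [le_div_iff₀ hn']
    by_contra! h
    exact hx (norm_le_iff_mem_box.1 (by push_cast; exact h.le))
  exact max_eq_left ((min_le_right _ _).trans (by linarith))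

theorem norm_unitVec {d : ℕ} (i : Fin d) : ‖unitVec i‖ = 1 := by
  rw [unitVec, Pi.norm_single, norm_one]

theorem abs_cutoff_sub_le {d n : ℕ} (x y : Site d) :
    |cutoff n y - cutoff n x| ≤ ‖y - x‖ / n := by
  have h1 : |‖x‖ - ‖y‖| ≤ ‖y - x‖ := by
    rw [abs_sub_comm]; exact abs_norm_sub_norm_le y x
  calc |cutoff n y - cutoff n x| ≤ |min 1 (2 - ‖y‖ / n) - min 1 (2 - ‖x‖ / n)| := by
        simpa [cutoff] using abs_max_sub_max_le_max 0 (min 1 (2 - ‖y‖ / n)) 0 (min 1 (2 - ‖x‖ / n))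
    _ ≤ |(2 - ‖y‖ / n) - (2 - ‖x‖ / n)| := by
        simpa using abs_min_sub_min_le_max 1 (2 - ‖y‖ / n) 1 (2 - ‖x‖ / n)
    _ = |‖x‖ - ‖y‖| / n := by
        rw [show (2 - ‖y‖ / n) - (2 - ‖x‖ / n) = (‖x‖ - ‖y‖) / n by ring, abs_div, Nat.abs_cast]
    _ ≤ ‖y - x‖ / n := by gcongr

theorem enorm_cutoff_mul_sub_le {d n : ℕ} (hn : 1 ≤ n) (u : Site d → ℝ) (x : Site d) (i : Fin d) :
    ‖cutoff n (x + unitVec i) * u (x + unitVec i) - cutoff n x * u x‖ₑ ≤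
      ‖u (x + unitVec i) - u x‖ₑ + (n : ℝ≥0∞)⁻¹ * ‖u x‖ₑ := by
  set y := x + unitVec i with hy
  have hn' : (0 : ℝ) < n := by exact_mod_cast hn
  have h0 : cutoff n y * u y - cutoff n x * u x =
      cutoff n y * (u y - u x) + (cutoff n y - cutoff n x) * u x := by ring
  rw [h0]
  refine (enorm_add_le _ _).trans (add_le_add ?_ ?_)
  · rw [enorm_mul]
    refine mul_le_of_le_one_left' ?_
    rw [Real.enorm_eq_ofReal (cutoff_nonneg y), ENNReal.ofReal_le_one]
    exact cutoff_le_one y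
  · rw [enorm_mul]
    refine mul_le_mul' ?_ le_rfl
    rw [Real.enorm_eq_ofReal_abs, ← ENNReal.ofReal_natCast, ← ENNReal.ofReal_inv_of_pos hn']
    refine ENNReal.ofReal_le_ofReal ((abs_cutoff_sub_le x y).trans_eq ?_)
    rw [hy, add_sub_cancel_left, norm_unitVec, one_div]

theorem unitVec_mem_box {d : ℕ} (i : Fin d) : unitVec i ∈ box d 1 :=
  norm_le_iff_mem_box.1 (by rw [norm_unitVec]; norm_num)

/-- The Sobolev inequality on boxes. -/
theorem sobolev_box {d : ℕ} (hd : 2 ≤ d) {r : ℝ} (hr : 1 < r) (hrd : r < d) (u : Site d → ℝ)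
    {n : ℕ} (hn : 1 ≤ n) :
    (∑ x ∈ box d n, ‖u x‖ₑ ^ (d * r / (d - r))) ^ (1 / (d * r / (d - r))) ≤
      ENNReal.ofReal (2 * d * (r * (d - 1) / (d - r))) *
        ((∑ x ∈ box d (3 * n), gradPow r u x) ^ (1 / r) +
          d * ((n : ℝ≥0∞)⁻¹ * (∑ x ∈ box d (3 * n), ‖u x‖ₑ ^ r) ^ (1 / r))) := by
  have hr0 : 0 < r := by linarith
  have hd1 : (1 : ℝ≥0∞) ≤ d := by exact_mod_cast (by omega : 1 ≤ d)
  have hdr : (0 : ℝ) < d - r := by linarith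
  have hR0 : 0 < d * r / (d - r) := by
    have : (0 : ℝ) < d := by linarith
    positivity
  set f : Site d → ℝ := fun x => cutoff n x * u x with hf
  have hf0 : ∀ x ∉ box d (2 * n), f x = 0 := fun x hx => by simp [hf, cutoff_eq_zero hn hx]
  have hfs : f.support.Finite := (box d (2 * n)).finite_toSet.subset fun x hx => by
    by_contra h
    exact hx (hf0 x h)
  have hS := sobolev hd hr hrd hfs
  have hleft : ∑ x ∈ box d n, ‖u x‖ₑ ^ (d * r / (d - r)) ≤
      ∑' x, ‖f x‖ₑ ^ (d * r / (d - r)) := by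
    refine le_trans (le_of_eq ?_) (ENNReal.sum_le_tsum (box d n))
    refine Finset.sum_congr rfl fun x hx => ?_
    simp only [hf, cutoff_eq_one hx, one_mul]
  -- The function f lives on B(2n), so its forward gradient lives on B(2n + 1), which B(3n) contains
  -- as n ≥ 1.
  have hright : ∑' x, ∑ i, ‖f (x + unitVec i) - f x‖ₑ ^ r =
      ∑ x ∈ box d (3 * n) ×ˢ (Finset.univ : Finset (Fin d)),
        ‖f (x.1 + unitVec x.2) - f x.1‖ₑ ^ r := by
    rw [Finset.sum_product, tsum_eq_sum]
    intro x hx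
    refine Finset.sum_eq_zero fun i _ => ?_
    have h1 : f x = 0 := hf0 x fun h => hx (box_mono (by omega) h)
    have h2 : f (x + unitVec i) = 0 := hf0 _ fun h => hx (by
      have := sub_mem_box h (unitVec_mem_box i)
      rw [add_sub_cancel_right] at this
      exact box_mono (by omega) this)
    simp [h1, h2, hr0]
  refine (ENNReal.rpow_le_rpow hleft (by positivity)).trans (hS.trans (mul_le_mul' le_rfl ?_))
  rw [hright]
  calc (∑ x ∈ box d (3 * n) ×ˢ (Finset.univ : Finset (Fin d)),
        ‖f (x.1 + unitVec x.2) - f x.1‖ₑ ^ r) ^ (1 / r)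
      ≤ (∑ x ∈ box d (3 * n) ×ˢ (Finset.univ : Finset (Fin d)),
        (‖u (x.1 + unitVec x.2) - u x.1‖ₑ + (n : ℝ≥0∞)⁻¹ * ‖u x.1‖ₑ) ^ r) ^ (1 / r) := by
        refine ENNReal.rpow_le_rpow (Finset.sum_le_sum fun x _ => ?_) (by positivity)
        exact ENNReal.rpow_le_rpow (enorm_cutoff_mul_sub_le hn u _ _) hr0.le
    _ ≤ _ := ENNReal.Lp_add_le _ _ _ hr.le
    _ ≤ _ := by
        refine add_le_add ?_ ?_
        · rw [Finset.sum_product]; rfl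
        · rw [Finset.sum_product]
          simp only [Finset.sum_const, Finset.card_univ, Fintype.card_fin, nsmul_eq_mul,
            ENNReal.mul_rpow_of_nonneg _ _ hr0.le]
          rw [← Finset.mul_sum, ← Finset.mul_sum,
            ENNReal.mul_rpow_of_nonneg _ _ (by positivity : 0 ≤ 1 / r),
            ENNReal.mul_rpow_of_nonneg _ _ (by positivity : 0 ≤ 1 / r), rpow_rpow_one_div _ hr0]
          refine mul_le_mul' ?_ le_rfl
          calc (d : ℝ≥0∞) ^ (1 / r) ≤ (d : ℝ≥0∞) ^ (1 : ℝ) :=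
                ENNReal.rpow_le_rpow_of_exponent_le hd1 (by rw [div_le_one hr0]; exact hr.le)
            _ = d := ENNReal.rpow_one _

theorem card_box_rpow {d : ℕ} (hd : d ≠ 0) (n : ℕ) :
    ((box d n).card : ℝ≥0∞) ^ (1 / (d : ℝ)) = 2 * n + 1 := by
  have hd' : (d : ℝ) ≠ 0 := by exact_mod_cast hd
  rw [card_box, Nat.cast_pow, ← ENNReal.rpow_natCast, ← ENNReal.rpow_mul, mul_one_div_cancel hd',
    ENNReal.rpow_one]
  push_cast
  rfl

/-- A function whose gradient has bounded `r`-averages on boxes grows at most linearly in the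
averaged norm with the Sobolev exponent. -/
theorem exists_eAvgNorm_le {d : ℕ} (hd : 2 ≤ d) {r : ℝ} (hr : 1 < r) (hrd : r < d) :
    ∃ C : ℝ≥0∞, C ≠ ∞ ∧ ∀ (u : Site d → ℝ) (δ : ℝ≥0∞),
      (∀ n, ∑ y ∈ box d n, gradPow r u y ≤ δ ^ r * (box d n).card) → ∀ n, 1 ≤ n →
      eAvgNorm (d * r / (d - r)) (box d n) u ≤ C * (n * δ + eAvgNorm r (box d 1) u) := by
  have hr0 : 0 < r := by linarith
  have hdr : (0 : ℝ) < d - r := by linarith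
  have hd0 : (0 : ℝ) < d := by linarith
  set K : ℝ≥0∞ := 8 * d * 12 ^ d with hK
  set S : ℝ≥0∞ := ENNReal.ofReal (2 * d * (r * (d - 1) / (d - r))) with hS
  refine ⟨S * (3 ^ d * 3 * (1 + 3 * d * K + d)), by finiteness, fun u δ hδ n hn => ?_⟩
  set R : ℝ := d * r / (d - r) with hR
  have hR0 : 0 < R := by positivity
  set b : ℝ≥0∞ := ((box d n).card : ℝ≥0∞) with hb
  set b3 : ℝ≥0∞ := ((box d (3 * n)).card : ℝ≥0∞) with hb3
  have hb0 : b ≠ 0 := card_box_ne_zero d n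
  have hbt : b ≠ ∞ := ENNReal.natCast_ne_top _
  have hb30 : b3 ≠ 0 := card_box_ne_zero d _
  have hb3t : b3 ≠ ∞ := ENNReal.natCast_ne_top _
  set a1 := eAvgNorm r (box d 1) u with ha1
  have hn0 : (n : ℝ≥0∞) ≠ 0 := by exact_mod_cast (by omega : n ≠ 0)
  have hnt : (n : ℝ≥0∞) ≠ ∞ := ENNReal.natCast_ne_top _
  have hb3b : b3 ≤ ((3 : ℕ) : ℝ≥0∞) ^ d * b := card_box_le (by omega)
  have hgrad : (∑ x ∈ box d (3 * n), gradPow r u x) ^ (1 / r) ≤ b3 ^ (1 / r) * δ := by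
    refine (ENNReal.rpow_le_rpow (hδ (3 * n)) (by positivity)).trans_eq ?_
    rw [ENNReal.mul_rpow_of_nonneg _ _ (by positivity), rpow_rpow_one_div _ hr0, mul_comm]
  have hsum : (∑ x ∈ box d (3 * n), ‖u x‖ₑ ^ r) ^ (1 / r) ≤ b3 ^ (1 / r) * (a1 + K * (3 * n) * δ) := by
    have h := eAvgNorm_le_of_gradPow_le hr.le u hδ (3 * n) (by omega)
    rw [eAvgNorm, ← hb3] at h
    calc (∑ x ∈ box d (3 * n), ‖u x‖ₑ ^ r) ^ (1 / r)
        = b3 ^ (1 / r) * (b3⁻¹ * ∑ x ∈ box d (3 * n), ‖u x‖ₑ ^ r) ^ (1 / r) := by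
          rw [← ENNReal.mul_rpow_of_nonneg _ _ (by positivity), ← mul_assoc,
            ENNReal.mul_inv_cancel hb30 hb3t, one_mul]
      _ ≤ _ := mul_le_mul' le_rfl (by push_cast at h; exact h)
  -- Since 1/r - 1/R = 1/d, the volume factors leave |B(n)|^(1/d) = 2n + 1: the source of the linear
  -- growth.
  have hpow : (b⁻¹) ^ (1 / R) * b3 ^ (1 / r) ≤ 3 ^ d * (3 * n) := by
    have h1 : b3 ^ (1 / r) ≤ 3 ^ d * b ^ (1 / r) := by
      refine (ENNReal.rpow_le_rpow hb3b (by positivity)).trans ?_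
      rw [ENNReal.mul_rpow_of_nonneg _ _ (by positivity)]
      refine mul_le_mul' ?_ le_rfl
      calc (((3 : ℕ) : ℝ≥0∞) ^ d) ^ (1 / r) ≤ (((3 : ℕ) : ℝ≥0∞) ^ d) ^ (1 : ℝ) :=
            ENNReal.rpow_le_rpow_of_exponent_le (one_le_pow₀ (by norm_num))
              (by rw [div_le_one hr0]; exact hr.le)
        _ = _ := by rw [ENNReal.rpow_one]; norm_num
    have h2 : (b⁻¹) ^ (1 / R) * b ^ (1 / r) = b ^ (1 / (d : ℝ)) := by
      rw [ENNReal.inv_rpow, ← ENNReal.rpow_neg, ← ENNReal.rpow_add _ _ hb0 hbt]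
      congr 1
      rw [hR]; field_simp; ring
    calc (b⁻¹) ^ (1 / R) * b3 ^ (1 / r) ≤ (b⁻¹) ^ (1 / R) * (3 ^ d * b ^ (1 / r)) :=
          mul_le_mul' le_rfl h1
      _ = 3 ^ d * ((b⁻¹) ^ (1 / R) * b ^ (1 / r)) := by ring
      _ = 3 ^ d * (2 * n + 1) := by rw [h2, hb, card_box_rpow (by omega)]
      _ ≤ 3 ^ d * (3 * n) := by
          refine mul_le_mul' le_rfl ?_
          exact_mod_cast (by omega : 2 * n + 1 ≤ 3 * n)
  have hinv : (n : ℝ≥0∞) * (n : ℝ≥0∞)⁻¹ = 1 := ENNReal.mul_inv_cancel hn0 hnt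
  calc eAvgNorm R (box d n) u
      = (b⁻¹) ^ (1 / R) * (∑ x ∈ box d n, ‖u x‖ₑ ^ R) ^ (1 / R) := by
        rw [eAvgNorm, ENNReal.mul_rpow_of_nonneg _ _ (by positivity)]
    _ ≤ (b⁻¹) ^ (1 / R) * (S * (b3 ^ (1 / r) * δ +
          d * ((n : ℝ≥0∞)⁻¹ * (b3 ^ (1 / r) * (a1 + K * (3 * n) * δ))))) := by
        refine mul_le_mul' le_rfl ((sobolev_box hd hr hrd u hn).trans ?_)
        exact mul_le_mul' le_rfl (add_le_add hgrad
          (mul_le_mul' le_rfl (mul_le_mul' le_rfl hsum)))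
    _ = ((b⁻¹) ^ (1 / R) * b3 ^ (1 / r)) * (S * (δ + d * ((n : ℝ≥0∞)⁻¹ *
          (a1 + K * (3 * n) * δ)))) := by ring
    _ ≤ (3 ^ d * (3 * n)) * (S * (δ + d * ((n : ℝ≥0∞)⁻¹ * (a1 + K * (3 * n) * δ)))) :=
        mul_le_mul' hpow le_rfl
    _ = S * (3 ^ d * 3 * (n * δ + d * ((n * (n : ℝ≥0∞)⁻¹) * (a1 + K * (3 * n) * δ)))) := by ring
    _ = S * (3 ^ d * 3 * ((1 + 3 * d * K) * (n * δ) + d * a1)) := by rw [hinv]; ring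
    _ ≤ S * (3 ^ d * 3 * ((1 + 3 * d * K + d) * (n * δ) + (1 + 3 * d * K + d) * a1)) := by
        refine mul_le_mul' le_rfl (mul_le_mul' le_rfl (add_le_add ?_ ?_))
        · exact mul_le_mul' le_self_add le_rfl
        · exact mul_le_mul' le_add_self le_rfl
    _ = _ := by ring

-- Maximal inequalities

theorem mem_closedBall_iff_sub_mem_box {d n : ℕ} {x y : Site d} :
    y ∈ Metric.closedBall x n ↔ y - x ∈ box d n := by
  rw [Metric.mem_closedBall, dist_eq_norm, norm_le_iff_mem_box]

/-- The finite maximal inequality on `ℤ^d`. -/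
theorem card_filter_mul_le {d : ℕ} (g : Site d → ℝ≥0∞) (l : ℝ≥0∞) (N : ℕ) (A : Finset (Site d))
    (hA : ∀ x ∈ A, x ∈ box d N ∧ ∃ n ≤ N, l * (box d n).card ≤ ∑ y ∈ box d n, g (x + y)) :
    l * A.card ≤ 4 ^ d * ∑ y ∈ box d (2 * N), g y := by
  classical
  choose! hAN m hmN hm using hA
  -- Boxes are the balls of the sup norm. Vitali's lemma allows any enlargement factor above 3; the
  -- integer 4 gives |B(4m)| ≤ 4^d |B(m)|.
  obtain ⟨U, hUA, hdisj, hcov⟩ := Vitali.exists_disjoint_subfamily_covering_enlargement_closedBall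
    (A : Set (Site d)) (fun x => x) (fun x => (m x : ℝ)) N
    (fun a ha => by exact_mod_cast hmN a ha) 4 (by norm_num)
  have hUfin : U.Finite := A.finite_toSet.subset hUA
  lift U to Finset (Site d) using hUfin
  have hUA' : ∀ b ∈ U, b ∈ A := fun b hb => hUA hb
  have hcard : (A.card : ℝ≥0∞) ≤ 4 ^ d * ∑ b ∈ U, ((box d (m b)).card : ℝ≥0∞) := by
    have h1 : A ⊆ U.biUnion fun b => (box d (4 * m b)).image (fun y => b + y) := by
      intro a ha
      obtain ⟨b, hb, hab⟩ := hcov a ha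
      refine Finset.mem_biUnion.2 ⟨b, hb, Finset.mem_image.2 ⟨a - b, ?_, by abel⟩⟩
      rw [← mem_closedBall_iff_sub_mem_box]
      push_cast
      exact hab (Metric.mem_closedBall_self (Nat.cast_nonneg _))
    calc (A.card : ℝ≥0∞) ≤ ∑ b ∈ U, ((box d (4 * m b)).card : ℝ≥0∞) := by
          exact_mod_cast (Finset.card_le_card h1).trans (Finset.card_biUnion_le.trans
            (Finset.sum_le_sum fun b _ => Finset.card_image_le))
      _ ≤ ∑ b ∈ U, ((4 : ℕ) : ℝ≥0∞) ^ d * (box d (m b)).card :=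
          Finset.sum_le_sum fun b _ => card_box_le (by omega)
      _ = _ := by rw [← Finset.mul_sum]; norm_num
  calc l * A.card ≤ l * (4 ^ d * ∑ b ∈ U, ((box d (m b)).card : ℝ≥0∞)) := mul_le_mul' le_rfl hcard
    _ = 4 ^ d * ∑ b ∈ U, l * ((box d (m b)).card : ℝ≥0∞) := by rw [← Finset.mul_sum]; ring
    _ ≤ 4 ^ d * ∑ b ∈ U, ∑ y ∈ box d (m b), g (b + y) :=
        mul_le_mul' le_rfl (Finset.sum_le_sum fun b hb => hm b (hUA' b hb))
    _ = 4 ^ d * ∑ b ∈ U, ∑ y ∈ (box d (m b)).image (fun y => b + y), g y := by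
        congr 1
        refine Finset.sum_congr rfl fun b _ => ?_
        rw [Finset.sum_image fun x _ y _ h => add_left_cancel h]
    _ = 4 ^ d * ∑ y ∈ U.biUnion (fun b => (box d (m b)).image (fun y => b + y)), g y := by
        rw [Finset.sum_biUnion]
        intro b hb c hc hbc
        refine Finset.disjoint_left.2 fun y hyb hyc => ?_
        refine Set.disjoint_left.1 (hdisj hb hc hbc) (?_ : y ∈ _) ?_
        · obtain ⟨z, hz, rfl⟩ := Finset.mem_image.1 hyb
          rw [mem_closedBall_iff_sub_mem_box]; simpa using hz
        · obtain ⟨z, hz, rfl⟩ := Finset.mem_image.1 hyc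
          rw [mem_closedBall_iff_sub_mem_box]; simpa using hz
    _ ≤ 4 ^ d * ∑ y ∈ box d (2 * N), g y := by
        refine mul_le_mul' le_rfl (Finset.sum_le_sum_of_subset fun y hy => ?_)
        obtain ⟨b, hb, hy⟩ := Finset.mem_biUnion.1 hy
        obtain ⟨z, hz, rfl⟩ := Finset.mem_image.1 hy
        rw [two_mul]
        exact add_mem_box (hAN b (hUA' b hb)) (box_mono (hmN b (hUA' b hb)) hz)

section

variable {d : ℕ} {Γ : Set (OrientedCycle d)}

theorem measurable_shift (x : Site d) : Measurable (shift x : Env Γ → Env Γ) :=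
  measurable_pi_iff.2 fun _ => measurable_pi_apply _

theorem shift_shift (x y : Site d) (ω : Env Γ) : shift y (shift x ω) = shift (x + y) ω := by
  funext a
  simp only [shift, add_assoc]

theorem lintegral_mul_sum_shift {P : Measure (Env Γ)} (hP : ∀ x : Site d, P.map (shift x) = P)
    {f : Env Γ → ℝ≥0∞} (hf : Measurable f) (c : ℝ≥0∞) (B : Finset (Site d)) :
    ∫⁻ ω, c * ∑ x ∈ B, f (shift x ω) ∂P = c * (B.card * ∫⁻ ω, f ω ∂P) := by
  have hfx : ∀ x : Site d, Measurable fun ω : Env Γ => f (shift x ω) :=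
    fun x => hf.comp (measurable_shift x)
  have hmp : ∀ x : Site d, ∫⁻ ω, f (shift x ω) ∂P = ∫⁻ ω, f ω ∂P := fun x =>
    MeasurePreserving.lintegral_comp ⟨measurable_shift x, hP x⟩ hf
  rw [lintegral_const_mul _ (Finset.measurable_sum _ fun x _ => hfx x),
    lintegral_finsetSum _ fun x _ => hfx x]
  simp only [hmp, Finset.sum_const, nsmul_eq_mul]

/-- The maximal inequality for stationary random fields. -/
theorem mul_measure_exists_lt_le {P : Measure (Env Γ)} [IsProbabilityMeasure P]
    (hP : ∀ x : Site d, P.map (shift x) = P) {f : Env Γ → ℝ≥0∞} (hf : Measurable f) (l : ℝ≥0∞) :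
    l * P {ω | ∃ n, l * (box d n).card < ∑ y ∈ box d n, f (shift y ω)} ≤ 8 ^ d * ∫⁻ ω, f ω ∂P := by
  classical
  set E : ℕ → Set (Env Γ) := fun N =>
    {ω | ∃ n ≤ N, l * (box d n).card < ∑ y ∈ box d n, f (shift y ω)} with hE
  have hEm : ∀ N, MeasurableSet (E N) := fun N => by
    have : E N = ⋃ n, ⋃ _ : n ≤ N, {ω | l * (box d n).card < ∑ y ∈ box d n, f (shift y ω)} := by
      ext ω; simp [hE]
    rw [this]
    refine MeasurableSet.iUnion fun n => MeasurableSet.iUnion fun _ =>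
      measurableSet_lt measurable_const ?_
    exact Finset.measurable_sum _ fun y _ => hf.comp (measurable_shift y)
  have hEmono : Monotone E := fun M N hMN ω ⟨n, hn, h⟩ => ⟨n, hn.trans hMN, h⟩
  have hunion : {ω | ∃ n, l * (box d n).card < ∑ y ∈ box d n, f (shift y ω)} = ⋃ N, E N := by
    ext ω
    simp only [hE, Set.mem_ofPred_eq, Set.mem_iUnion]
    exact ⟨fun ⟨n, h⟩ => ⟨n, n, le_rfl, h⟩, fun ⟨_, n, _, h⟩ => ⟨n, h⟩⟩
  rw [hunion, hEmono.measure_iUnion, ENNReal.mul_iSup]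
  refine iSup_le fun N => ?_
  set b : ℝ≥0∞ := ((box d N).card : ℝ≥0∞) with hb
  have hb0 : b ≠ 0 := card_box_ne_zero d N
  have hbt : b ≠ ∞ := ENNReal.natCast_ne_top _
  -- Transference: the lattice inequality is applied to y ↦ f(τ_y ω), counting the x in B(N) with
  -- τ_x ω in E_N. Integration and stationarity give both sides, and |B(2N)| ≤ 2^d |B(N)| turns 4^d
  -- into 8^d, uniformly in N.
  have hpt : ∀ ω : Env Γ, l * ∑ x ∈ box d N, (E N).indicator 1 (shift x ω) ≤
      4 ^ d * ∑ y ∈ box d (2 * N), f (shift y ω) := by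
    intro ω
    have h := card_filter_mul_le (fun y => f (shift y ω)) l N
      ((box d N).filter fun x => shift x ω ∈ E N) (fun x hx => by
        rw [Finset.mem_filter] at hx
        obtain ⟨n, hn, h⟩ := hx.2
        refine ⟨hx.1, n, hn, ?_⟩
        simpa only [shift_shift] using h.le)
    refine le_trans (le_of_eq ?_) h
    congr 1
    rw [Finset.card_filter]
    push_cast
    exact Finset.sum_congr rfl fun x _ => by simp [Set.indicator_apply]
  have hint := lintegral_mono (μ := P) hpt
  rw [lintegral_mul_sum_shift hP (measurable_one.indicator (hEm N)), lintegral_mul_sum_shift hP hf,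
    lintegral_indicator_one (hEm N)] at hint
  rw [← hb] at hint
  have hcard : ((box d (2 * N)).card : ℝ≥0∞) ≤ ((2 : ℕ) : ℝ≥0∞) ^ d * b := card_box_le (by omega)
  refine (ENNReal.mul_le_mul_iff_right hb0 hbt).1 ?_
  calc b * (l * P (E N)) = l * (b * P (E N)) := by ring
    _ ≤ 4 ^ d * ((box d (2 * N)).card * ∫⁻ ω, f ω ∂P) := hint
    _ ≤ 4 ^ d * ((((2 : ℕ) : ℝ≥0∞) ^ d * b) * ∫⁻ ω, f ω ∂P) := by gcongr
    _ = b * (((4 : ℝ≥0∞) ^ d * ((2 : ℕ) : ℝ≥0∞) ^ d) * ∫⁻ ω, f ω ∂P) := by ring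
    _ = b * (8 ^ d * ∫⁻ ω, f ω ∂P) := by rw [← mul_pow]; norm_num

end

-- Almost sure sublinearity of limits of horizontal gradients

theorem eAvgNorm_add_le {d : ℕ} {r : ℝ} (hr : 1 ≤ r) (n : ℕ) {u v : Site d → ℝ} {c : ℝ≥0∞}
    (hv : ∀ x, ‖v x‖ₑ ≤ c) :
    eAvgNorm r (box d n) (u + v) ≤ eAvgNorm r (box d n) u + c := by
  have hr0 : 0 < r := by linarith
  have hb0 := card_box_ne_zero d n
  have hbt : ((box d n).card : ℝ≥0∞) ≠ ∞ := ENNReal.natCast_ne_top _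
  set b : ℝ≥0∞ := ((box d n).card : ℝ≥0∞) with hb
  calc eAvgNorm r (box d n) (u + v)
      = (b⁻¹) ^ (1 / r) * (∑ x ∈ box d n, ‖u x + v x‖ₑ ^ r) ^ (1 / r) := by
        rw [eAvgNorm, ENNReal.mul_rpow_of_nonneg _ _ (by positivity)]; rfl
    _ ≤ (b⁻¹) ^ (1 / r) * ((∑ x ∈ box d n, ‖u x‖ₑ ^ r) ^ (1 / r) +
          (∑ _x ∈ box d n, c ^ r) ^ (1 / r)) := by
        refine mul_le_mul' le_rfl (le_trans ?_ (ENNReal.Lp_add_le _ _ _ hr))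
        refine ENNReal.rpow_le_rpow (Finset.sum_le_sum fun x _ => ?_) (by positivity)
        exact ENNReal.rpow_le_rpow ((enorm_add_le _ _).trans (add_le_add le_rfl (hv x))) hr0.le
    _ = eAvgNorm r (box d n) u + c := by
        rw [mul_add, eAvgNorm, ← hb, ENNReal.mul_rpow_of_nonneg _ _ (by positivity : 0 ≤ 1 / r)]
        congr 1
        rw [← ENNReal.mul_rpow_of_nonneg _ _ (by positivity : 0 ≤ 1 / r), Finset.sum_const,
          nsmul_eq_mul, ← mul_assoc, ← hb, ENNReal.inv_mul_cancel hb0 hbt, one_mul,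
          rpow_rpow_one_div _ hr0]

theorem ofReal_avgNorm {d : ℕ} {r : ℝ} (hr : 0 < r) (n : ℕ) (u : Site d → ℝ) :
    ENNReal.ofReal (avgNorm r (box d n) u) = eAvgNorm r (box d n) u := by
  have hb : (0 : ℝ) < (box d n).card := by
    have h := card_box d n
    rw [h]; positivity
  have hs : ∀ x ∈ box d n, 0 ≤ |u x| ^ r := fun x _ => Real.rpow_nonneg (abs_nonneg _) _
  rw [avgNorm, eAvgNorm, ← ENNReal.ofReal_rpow_of_nonneg
    (mul_nonneg (by positivity) (Finset.sum_nonneg hs)) (by positivity),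
    ENNReal.ofReal_mul (by positivity), ENNReal.ofReal_inv_of_pos hb, ENNReal.ofReal_natCast,
    ENNReal.ofReal_sum_of_nonneg hs]
  congr 3
  funext x
  rw [← ENNReal.ofReal_rpow_of_nonneg (abs_nonneg _) hr.le, Real.enorm_eq_ofReal_abs]

theorem eAvgNorm_ne_top {d : ℕ} {r : ℝ} (hr : 0 < r) (n : ℕ) (u : Site d → ℝ) :
    eAvgNorm r (box d n) u ≠ ∞ := by
  rw [← ofReal_avgNorm hr]; exact ENNReal.ofReal_ne_top

section

variable {d : ℕ} {Γ : Set (OrientedCycle d)}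

theorem measurable_horizontalD {φ : Env Γ → ℝ} (hφ : Measurable φ) (z : Site d) :
    Measurable fun ω => horizontalD φ ω z :=
  (hφ.comp (measurable_shift z)).sub hφ

/-- If `f j → 0` in `L¹`, then almost surely the box averages of some `f j` are at most `l`. -/
theorem ae_forall_exists_sum_le {P : Measure (Env Γ)} [IsProbabilityMeasure P]
    (hP : ∀ x : Site d, P.map (shift x) = P) {f : ℕ → Env Γ → ℝ≥0∞} (hf : ∀ j, Measurable (f j))
    (hlim : Tendsto (fun j => ∫⁻ ω, f j ω ∂P) atTop (𝓝 0)) {l : ℝ≥0∞} (hl : l ≠ 0) :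
    ∀ᵐ ω ∂P, ∃ j, ∀ n, ∑ y ∈ box d n, f j (shift y ω) ≤ l * (box d n).card := by
  rw [ae_iff]
  push Not
  -- The event that every j fails lies in the failure event of each single j, whose maximal bound
  -- tends to 0.
  have hle : ∀ j, l * P {ω | ∀ j, ∃ n, l * (box d n).card < ∑ y ∈ box d n, f j (shift y ω)} ≤
      8 ^ d * ∫⁻ ω, f j ω ∂P := fun j => by
    refine le_trans (mul_le_mul' le_rfl (measure_mono ?_)) (mul_measure_exists_lt_le hP (hf j) l)
    exact fun ω hω => hω j
  have h0 : Tendsto (fun j => 8 ^ d * ∫⁻ ω, f j ω ∂P) atTop (𝓝 0) := by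
    have := ENNReal.Tendsto.const_mul (a := (8 : ℝ≥0∞) ^ d) hlim (Or.inr (by finiteness))
    rwa [mul_zero] at this
  have h1 := ge_of_tendsto' h0 hle
  exact (mul_eq_zero.1 (le_antisymm h1 zero_le)).resolve_left hl

/-- Sublinearity of a cocycle which is a limit of horizontal gradients in `L^r`. -/
theorem ae_tendsto_eAvgNorm {P : Measure (Env Γ)} [IsProbabilityMeasure P]
    (hP : ∀ x : Site d, P.map (shift x) = P) (hd : 2 ≤ d) {r : ℝ} (hr : 1 < r) (hrd : r < d)
    {χ : Env Γ → Site d → ℝ} (hχ : ∀ x, Measurable fun ω => χ ω x) (hco : IsCocycle P χ)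
    (happrox : ∀ ε : ℝ≥0∞, 0 < ε → ∃ φ : Env Γ → ℝ, Measurable φ ∧ (∃ C, ∀ ω, |φ ω| ≤ C) ∧
      ∫⁻ ω, ∑ i, ‖χ ω (unitVec i) - horizontalD φ ω (unitVec i)‖ₑ ^ r ∂P < ε) :
    ∀ᵐ ω ∂P, Tendsto (fun n : ℕ => (n : ℝ≥0∞)⁻¹ *
      eAvgNorm (d * r / (d - r)) (box d n) (χ ω)) atTop (𝓝 0) := by
  have hr0 : 0 < r := by linarith
  have hdr : (0 : ℝ) < d - r := by linarith
  have hR : 1 ≤ d * r / (d - r) := by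
    rw [le_div_iff₀ hdr]; nlinarith
  have hpos : ∀ k : ℕ, (0 : ℝ≥0∞) < (k : ℝ≥0∞)⁻¹ := fun k =>
    ENNReal.inv_pos.2 (ENNReal.natCast_ne_top k)
  -- The j-th error is below 1/j; for j = 0 this reads ∞ and is harmless.
  choose φ hφm hφb hφ using fun j : ℕ => happrox _ (hpos j)
  choose M hM using hφb
  set f : ℕ → Env Γ → ℝ≥0∞ := fun j ω =>
    ∑ i, ‖χ ω (unitVec i) - horizontalD (φ j) ω (unitVec i)‖ₑ ^ r with hf
  have hfm : ∀ j, Measurable (f j) := fun j => Finset.measurable_sum _ fun i _ =>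
    ((hχ _).sub (measurable_horizontalD (hφm j) _)).enorm.pow_const r
  have hlim : Tendsto (fun j => ∫⁻ ω, f j ω ∂P) atTop (𝓝 0) :=
    tendsto_of_tendsto_of_tendsto_of_le_of_le tendsto_const_nhds
      ENNReal.tendsto_inv_nat_nhds_zero (fun _ => zero_le) fun j => (hφ j).le
  have hae : ∀ᵐ ω ∂P, ∀ k : ℕ, ∃ j, ∀ n, ∑ y ∈ box d n, f j (shift y ω) ≤
      (((k + 1 : ℕ) : ℝ≥0∞)⁻¹) ^ r * (box d n).card := by
    refine ae_all_iff.2 fun k => ae_forall_exists_sum_le hP hfm hlim ?_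
    simp [ENNReal.rpow_eq_zero_iff, hr0.not_gt]
  obtain ⟨C, hC, hmain⟩ := exists_eAvgNorm_le hd hr hrd
  filter_upwards [hae, hco] with ω hω hcoω
  have hbound : ∀ k : ℕ, ∃ K : ℝ≥0∞, K ≠ ∞ ∧ ∀ n : ℕ, 1 ≤ n →
      (n : ℝ≥0∞)⁻¹ * eAvgNorm (d * r / (d - r)) (box d n) (χ ω) ≤
        C * ((k + 1 : ℕ) : ℝ≥0∞)⁻¹ + K * (n : ℝ≥0∞)⁻¹ := by
    intro k
    obtain ⟨j, hj⟩ := hω k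
    set u : Site d → ℝ := fun x => χ ω x - φ j (shift x ω) with hu
    -- The cocycle property makes the increment of χ at x a function of the shifted environment.
    have hgrad : ∀ x, gradPow r u x = f j (shift x ω) := fun x => by
      refine Finset.sum_congr rfl fun i _ => ?_
      have h := hcoω x (x + unitVec i)
      rw [add_sub_cancel_left] at h
      rw [← h, horizontalD, shift_shift]
      simp only [hu]
      congr 2
      ring
    have h1 := hmain u _ (fun n => by simpa only [hgrad] using hj n)
    have hχu : χ ω = u + fun x => φ j (shift x ω) := by
      funext x; simp [hu]
    refine ⟨C * eAvgNorm r (box d 1) u + ENNReal.ofReal (M j), ?_, fun n hn => ?_⟩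
    · exact ENNReal.add_ne_top.2 ⟨ENNReal.mul_ne_top hC (eAvgNorm_ne_top hr0 1 u),
        ENNReal.ofReal_ne_top⟩
    have h2 : eAvgNorm (d * r / (d - r)) (box d n) (χ ω) ≤
        C * (n * ((k + 1 : ℕ) : ℝ≥0∞)⁻¹ + eAvgNorm r (box d 1) u) + ENNReal.ofReal (M j) := by
      rw [hχu]
      refine (eAvgNorm_add_le hR n fun x => ?_).trans (add_le_add (h1 n hn) le_rfl)
      rw [Real.enorm_eq_ofReal_abs]
      exact ENNReal.ofReal_le_ofReal (hM j _)
    have hinv : (n : ℝ≥0∞)⁻¹ * (n : ℝ≥0∞) = 1 :=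
      ENNReal.inv_mul_cancel (by exact_mod_cast (by omega : n ≠ 0)) (ENNReal.natCast_ne_top n)
    calc (n : ℝ≥0∞)⁻¹ * eAvgNorm (d * r / (d - r)) (box d n) (χ ω)
        ≤ (n : ℝ≥0∞)⁻¹ * (C * (n * ((k + 1 : ℕ) : ℝ≥0∞)⁻¹ + eAvgNorm r (box d 1) u) +
            ENNReal.ofReal (M j)) := mul_le_mul' le_rfl h2
      _ = C * (((n : ℝ≥0∞)⁻¹ * n) * ((k + 1 : ℕ) : ℝ≥0∞)⁻¹) +
            (C * eAvgNorm r (box d 1) u + ENNReal.ofReal (M j)) * (n : ℝ≥0∞)⁻¹ := by ring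
      _ = _ := by rw [hinv, one_mul]
  have hk0 : Tendsto (fun k : ℕ => C * ((k + 1 : ℕ) : ℝ≥0∞)⁻¹) atTop (𝓝 0) := by
    have := ENNReal.Tendsto.const_mul (a := C)
      (ENNReal.tendsto_inv_nat_nhds_zero.comp (tendsto_add_atTop_nat 1)) (Or.inr hC)
    rwa [mul_zero] at this
  rw [ENNReal.tendsto_nhds_zero]
  intro ε hε
  have hε2 : 0 < ε / 2 := ENNReal.half_pos hε.ne'
  obtain ⟨k, hk⟩ := ((ENNReal.tendsto_nhds_zero.1 hk0) _ hε2).exists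
  obtain ⟨K, hK, hKn⟩ := hbound k
  have hn0 : Tendsto (fun n : ℕ => K * (n : ℝ≥0∞)⁻¹) atTop (𝓝 0) := by
    have := ENNReal.Tendsto.const_mul (a := K) ENNReal.tendsto_inv_nat_nhds_zero (Or.inr hK)
    rwa [mul_zero] at this
  filter_upwards [(ENNReal.tendsto_nhds_zero.1 hn0) _ hε2, eventually_ge_atTop 1] with n hn hn1
  exact (hKn n hn1).trans ((add_le_add hk hn).trans_eq (ENNReal.add_halves ε))

end

-- From weighted L² to unweighted L^r

/-- Countability makes the series defining `edgeWeight` measurable. -/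
instance countable_orientedCycle (d : ℕ) : Countable (OrientedCycle d) := by
  refine Function.Injective.countable
    (f := fun γ : OrientedCycle d => (⟨γ.length, γ.vertex⟩ : Σ n : ℕ, (Fin (n + 1) → Site d))) ?_
  rintro ⟨n, v, _, _, _, _⟩ ⟨m, w, _, _, _, _⟩ h
  obtain ⟨rfl, h⟩ := Sigma.mk.inj_iff.1 h
  obtain rfl := eq_of_heq h
  rfl

theorem avgNorm_nonneg {d : ℕ} (r : ℝ) (B : Finset (Site d)) (u : Site d → ℝ) :
    0 ≤ avgNorm r B u :=
  Real.rpow_nonneg (mul_nonneg (by positivity)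
    (Finset.sum_nonneg fun _ _ => Real.rpow_nonneg (abs_nonneg _) _)) _

theorem unitVec_mem_neighbors {d : ℕ} (i : Fin d) : unitVec i ∈ neighbors d := by
  rw [mem_neighbors, Finset.sum_eq_single i]
  · simp [unitVec]
  · intro j _ hj
    simp [unitVec, hj]
  · simp

/-- Hölder's inequality with a weight `w` whose inverse is in `L^q`. -/
theorem exists_lintegral_rpow_le {α : Type*} [MeasurableSpace α] {μ : Measure α}
    {w : α → ℝ≥0∞} (hw : Measurable w) {q : ℝ≥0∞} (hq : 1 < q)
    (hwq : eLpNorm (fun a => (w a)⁻¹) q μ < ∞) :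
    ∃ K : ℝ≥0∞, K ≠ ∞ ∧ ∀ ψ : α → ℝ, Measurable ψ →
      ∫⁻ a, w a * ENNReal.ofReal (ψ a ^ 2) ∂μ ≠ ∞ →
      ∫⁻ a, ‖ψ a‖ₑ ^ (2 / (1 + (q⁻¹).toReal)) ∂μ ≤
        K * (∫⁻ a, w a * ENNReal.ofReal (ψ a ^ 2) ∂μ) ^ (1 / (1 + (q⁻¹).toReal)) := by
  have hq0 : q ≠ 0 := (zero_lt_one.trans hq).ne'
  set s : ℝ := (q⁻¹).toReal with hs
  have hs0 : 0 ≤ s := ENNReal.toReal_nonneg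
  -- The weight is almost surely nonzero, so w w⁻¹ = 1 can be inserted wherever w is finite; where w
  -- = ∞, finite energy forces ψ = 0.
  have hwae : ∀ᵐ a ∂μ, (w a)⁻¹ ≠ ∞ := by
    rcases eq_or_ne q ∞ with rfl | hqt
    · rw [eLpNorm_exponent_top] at hwq
      filter_upwards [enorm_ae_le_eLpNormEssSup (fun a => (w a)⁻¹) μ] with a ha
      exact (lt_of_le_of_lt ha hwq).ne
    · have h := lintegral_rpow_enorm_lt_top_of_eLpNorm_lt_top hq0 hqt hwq
      have hm : Measurable fun a => ‖(w a)⁻¹‖ₑ ^ q.toReal := hw.inv.enorm.pow_const _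
      filter_upwards [ae_lt_top hm h.ne] with a ha
      intro h0
      simp [h0, ENNReal.toReal_pos hq0 hqt] at ha
  have hpt : ∀ ψ : α → ℝ, Measurable ψ → ∫⁻ a, w a * ENNReal.ofReal (ψ a ^ 2) ∂μ ≠ ∞ →
      ∀ᵐ a ∂μ, ‖ψ a‖ₑ ^ (2 / (1 + s)) ≤
        (w a * ENNReal.ofReal (ψ a ^ 2)) ^ (1 / (1 + s)) * ((w a)⁻¹) ^ (1 / (1 + s)) := by
    intro ψ hψ hfin
    have hm : Measurable fun a => w a * ENNReal.ofReal (ψ a ^ 2) :=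
      hw.mul (hψ.pow_const 2).ennreal_ofReal
    filter_upwards [hwae, ae_lt_top hm hfin] with a h1 h2
    have hsq : ENNReal.ofReal (ψ a ^ 2) = ‖ψ a‖ₑ ^ (2 : ℝ) := by
      rw [Real.enorm_eq_ofReal_abs, ENNReal.ofReal_rpow_of_nonneg (abs_nonneg _) (by norm_num)]
      norm_num
    rw [← ENNReal.mul_rpow_of_nonneg _ _ (by positivity), show 2 / (1 + s) = 2 * (1 / (1 + s)) by ring,
      ENNReal.rpow_mul, ← hsq]
    refine ENNReal.rpow_le_rpow ?_ (by positivity)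
    have hw0 : w a ≠ 0 := fun h => h1 (by simp [h])
    rcases eq_or_ne (w a) ∞ with hwt | hwt
    · have h3 : ENNReal.ofReal (ψ a ^ 2) = 0 := by
        by_contra h
        rw [hwt, ENNReal.top_mul h] at h2
        exact lt_irrefl _ h2
      simp [h3]
    · rw [mul_comm (w a), mul_assoc, ENNReal.mul_inv_cancel hw0 hwt, mul_one]
  rcases eq_or_ne q ∞ with rfl | hqt
  · have hs1 : s = 0 := by simp [hs]
    rw [eLpNorm_exponent_top] at hwq
    refine ⟨_, hwq.ne, fun ψ hψ hfin => ?_⟩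
    have h := hpt ψ hψ hfin
    simp only [hs1, add_zero, div_one, ENNReal.rpow_one] at h ⊢
    rw [mul_comm, ← lintegral_mul_const' _ _ hwq.ne]
    refine lintegral_mono_ae ?_
    filter_upwards [h, enorm_ae_le_eLpNormEssSup (fun a => (w a)⁻¹) μ] with a h1 h2
    exact h1.trans (mul_le_mul' le_rfl h2)
  · have hqr : s = q.toReal⁻¹ := by rw [hs, ENNReal.toReal_inv]
    have hq1 : 0 < q.toReal := ENNReal.toReal_pos hq0 hqt
    have hs1 : 0 < s := by rw [hqr]; positivity
    have hI : ∫⁻ a, ((w a)⁻¹) ^ q.toReal ∂μ ≠ ∞ :=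
      (lintegral_rpow_enorm_lt_top_of_eLpNorm_lt_top hq0 hqt hwq).ne
    -- The second exponent raises (w⁻¹)^(1/(1+s)) to exactly the power q, the first restores the
    -- energy.
    have hconj : (1 + s).HolderConjugate ((1 + s) / s) := by
      rw [Real.holderConjugate_iff]
      refine ⟨by linarith, ?_⟩
      field_simp
    refine ⟨_, ENNReal.rpow_ne_top_of_nonneg (by positivity : 0 ≤ 1 / ((1 + s) / s)) hI,
      fun ψ hψ hfin => ?_⟩
    have hm : Measurable fun a => w a * ENNReal.ofReal (ψ a ^ 2) :=
      hw.mul (hψ.pow_const 2).ennreal_ofReal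
    refine (lintegral_mono_ae (hpt ψ hψ hfin)).trans ?_
    refine (ENNReal.lintegral_mul_le_Lp_mul_Lq μ hconj (hm.pow_const _).aemeasurable
      (hw.inv.pow_const _).aemeasurable).trans_eq ?_
    have e1 : 1 / (1 + s) * (1 + s) = 1 := by field_simp
    have e2 : 1 / (1 + s) * ((1 + s) / s) = q.toReal := by
      rw [hqr]; field_simp
    simp only [← ENNReal.rpow_mul, e1, e2, ENNReal.rpow_one]
    rw [mul_comm]
    rfl

section

variable {d : ℕ} {Γ : Set (OrientedCycle d)}

theorem measurable_edgeWeight (x y : Site d) : Measurable fun ω : Env Γ => edgeWeight ω x y := by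
  classical
  unfold edgeWeight
  refine Measurable.tsum fun γ => Measurable.tsum fun z => ?_
  split_ifs
  · exact (measurable_pi_apply (γ, z)).coe_nnreal_ennreal
  · exact measurable_const

theorem measurable_symWeight (x y : Site d) : Measurable fun ω : Env Γ => symWeight ω x y :=
  ((measurable_edgeWeight x y).add (measurable_edgeWeight y x)).div_const 2

/-- Elements of `L²_pot` are limits of horizontal gradients in `L^r` with `1/r = 1/2 + 1/(2q)`. -/
theorem exists_lintegral_lt_of_memL2pot {P : Measure (Env Γ)} {q : ℝ≥0∞} (hq : 1 < q)
    (hlower : ∀ z ∈ neighbors d, eLpNorm (fun ω : Env Γ => (symWeight ω 0 z)⁻¹) q P < ∞)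
    {Ψ : Env Γ → Site d → ℝ} (hΨ : MemL2pot P Ψ) (ε : ℝ≥0∞) (hε : 0 < ε) :
    ∃ φ : Env Γ → ℝ, Measurable φ ∧ (∃ C, ∀ ω, |φ ω| ≤ C) ∧
      ∫⁻ ω, ∑ i, ‖Ψ ω (unitVec i) - horizontalD φ ω (unitVec i)‖ₑ ^
        (2 / (1 + (q⁻¹).toReal)) ∂P < ε := by
  set s : ℝ := (q⁻¹).toReal with hs
  have hs0 : 0 ≤ s := ENNReal.toReal_nonneg
  have hα : 0 < 1 / (1 + s) := by positivity
  choose K hK hKψ using fun i : Fin d => exists_lintegral_rpow_le (μ := P)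
    (measurable_symWeight 0 (unitVec i)) hq (hlower _ (unitVec_mem_neighbors i))
  have hlim : Tendsto (fun t : ℝ≥0∞ => (∑ i, K i) * (2 * t) ^ (1 / (1 + s))) (𝓝 0) (𝓝 0) := by
    have h1 : Tendsto (fun t : ℝ≥0∞ => 2 * t) (𝓝 0) (𝓝 0) := by
      have := ENNReal.Tendsto.const_mul (a := (2 : ℝ≥0∞)) (tendsto_id (x := 𝓝 0))
        (Or.inr ENNReal.ofNat_ne_top)
      simpa using this
    have h2 := ((ENNReal.continuous_rpow_const (y := 1 / (1 + s))).tendsto 0).comp h1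
    rw [ENNReal.zero_rpow_of_pos hα] at h2
    have h3 := ENNReal.Tendsto.const_mul (a := ∑ i, K i) h2
      (Or.inr (ENNReal.sum_ne_top.2 fun i _ => hK i))
    rwa [mul_zero] at h3
  -- The energy tolerance t makes the Hölder bound smaller than ε; t < 1 only ensures finite energy.
  -- The factor 2 undoes the ½ in `covNormSq`.
  obtain ⟨t, ⟨htε, ht1⟩, ht0⟩ := ((((hlim.eventually_lt_const hε).and
    (eventually_lt_nhds zero_lt_one)).filter_mono
      (nhdsWithin_le_nhds (s := Set.Ioi 0))).and self_mem_nhdsWithin).exists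
  obtain ⟨φ, hφm, hφb, hφ⟩ := hΨ.mem_closure t ht0
  refine ⟨φ, hφm, hφb, lt_of_le_of_lt ?_ htε⟩
  have hψm : ∀ i : Fin d, Measurable fun ω => Ψ ω (unitVec i) - horizontalD φ ω (unitVec i) :=
    fun i => (hΨ.memL2cov.measurable _ (unitVec_mem_neighbors i)).sub
      (measurable_horizontalD hφm _)
  have hen : ∀ i : Fin d, ∫⁻ ω, symWeight ω 0 (unitVec i) *
      ENNReal.ofReal ((Ψ ω (unitVec i) - horizontalD φ ω (unitVec i)) ^ 2) ∂P ≤ 2 * t := by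
    intro i
    refine le_trans (lintegral_mono fun ω => Finset.single_le_sum
      (f := fun z => symWeight ω 0 z * ENNReal.ofReal ((Ψ ω z - horizontalD φ ω z) ^ 2))
      (fun _ _ => zero_le) (unitVec_mem_neighbors i)) ?_
    have h := mul_le_mul' (le_refl (2 : ℝ≥0∞)) hφ.le
    rwa [covNormSq, ← mul_assoc, ENNReal.mul_inv_cancel (by norm_num) (by norm_num), one_mul] at h
  have h2t : 2 * t ≠ ∞ := ENNReal.mul_ne_top (by norm_num) (ht1.trans ENNReal.one_lt_top).ne
  rw [lintegral_finsetSum _ fun i _ => (hψm i).enorm.pow_const _, Finset.sum_mul]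
  refine Finset.sum_le_sum fun i _ => (hKψ i _ (hψm i) (ne_top_of_le_ne_top h2t (hen i))).trans ?_
  exact mul_le_mul' le_rfl (ENNReal.rpow_le_rpow (hen i) hα.le)

end

end CyclicWalk

-- Identification of the exponents

theorem mainTheorem6 (d : ℕ) (hd : 2 ≤ d) (Γ : Set (CyclicWalk.OrientedCycle d))
    (hΓ : CyclicWalk.CoversNeighbors Γ)
    (P : Measure (CyclicWalk.Env Γ)) [IsProbabilityMeasure P]
    (hP : CyclicWalk.IsStationaryErgodic P)
    (p q : ℝ≥0∞) (hp : 1 < p) (hq : 1 < q) (hpq : p⁻¹ + q⁻¹ < 2 / (d : ℝ≥0∞))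
    (hdq : d = 2 → q ≠ ∞)
    (hmom : CyclicWalk.MomentCondition P p q)
    (χ : Fin d → CyclicWalk.Env Γ → CyclicWalk.Site d → ℝ)
    (hχ : ∀ i, CyclicWalk.IsCorrector P i (χ i)) :
    ∀ᵐ ω ∂P, ∀ i : Fin d,
      Tendsto (fun n : ℕ => (1 / (n : ℝ)) *
        CyclicWalk.avgNorm (2 * CyclicWalk.rho d q) (CyclicWalk.box d n) (χ i ω))
        atTop (𝓝 0) := by
  rw [ae_all_iff]
  intro i
  set s : ℝ := (q⁻¹).toReal with hs
  have hs0 : 0 ≤ s := ENNReal.toReal_nonneg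
  have hs1 : s < 1 := by
    have h := ENNReal.toReal_strict_mono ENNReal.one_ne_top (ENNReal.inv_lt_one.2 hq)
    rwa [ENNReal.toReal_one] at h
  have hd' : (2 : ℝ) ≤ d := by exact_mod_cast hd
  -- Equivalent to r < d. In dimension 2 it needs 1/q > 0, hence the exclusion of q = ∞.
  have hds : 0 < (d : ℝ) - 2 + d * s := by
    rcases hd.eq_or_lt with h2 | h2
    · have hs2 : 0 < s := ENNReal.toReal_pos (ENNReal.inv_ne_zero.2 (hdq h2.symm))
        (ENNReal.inv_ne_top.2 (zero_lt_one.trans hq).ne')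
      nlinarith
    · have : (2 : ℝ) < d := by exact_mod_cast h2
      nlinarith
  have hr : 1 < 2 / (1 + s) := by rw [lt_div_iff₀ (by linarith)]; linarith
  have hrd : 2 / (1 + s) < d := by rw [div_lt_iff₀ (by linarith)]; linarith
  have hR : d * (2 / (1 + s)) / (d - 2 / (1 + s)) = 2 * CyclicWalk.rho d q := by
    have h1 : (d : ℝ) - 2 / (1 + s) = (d - 2 + d * s) / (1 + s) := by
      field_simp
      ring
    rw [h1, CyclicWalk.rho, ← hs]
    field_simp
  have hρ : 0 < 2 * CyclicWalk.rho d q := by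
    rw [CyclicWalk.rho, ← hs]; positivity
  filter_upwards [CyclicWalk.ae_tendsto_eAvgNorm hP.stationary hd hr hrd (hχ i).measurable
    (hχ i).cocycle
    (CyclicWalk.exists_lintegral_lt_of_memL2pot hq hmom.lower (hχ i).memL2pot)] with ω hω
  rw [hR] at hω
  have h := (ENNReal.tendsto_toReal ENNReal.zero_ne_top).comp hω
  rw [ENNReal.toReal_zero] at h
  refine h.congr fun n => ?_
  rw [Function.comp_apply, ENNReal.toReal_mul, ← CyclicWalk.ofReal_avgNorm hρ,
    ENNReal.toReal_ofReal (CyclicWalk.avgNorm_nonneg _ _ _), ENNReal.toReal_inv,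
    ENNReal.toReal_natCast, one_div]
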